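/- Let $P$ be an infinite field. For a finite set $X$ let $P[X]$ be the polynomial algebra over $P$ in the variables $X$. For a field extension $L$ of $P$ and $U\subseteq P[X]$ put $U'_L=\{\mu\in\mathrm{Hom}_P(P[X],L) : U\subseteq\ker\mu\}$ and $U''_L=\bigcap_{\mu\in U'_L}\ker\mu$ (which is $P[X]$ if $U'_L$ is empty). The sets of the form $U'_L$ are called algebraic sets over $L$. Let $K_P(L)$ be the category whose objects are the pairs $(X,A)$ with $X$ a finite set and $A\subseteq\mathrm{Hom}_P(P[X],L)$ an algebraic set, and whose morphisms $(X,A)\to(Y,B)$ are the maps $A\to B$ of the form $\nu\mapsto\nu\circ s$ for some homomorphism of $P$-algebras $s:P[Y]\to P[X]$. Two extensions $L_1,L_2$ of $P$ are geometrically equivalent if $U''_{L_1}=U''_{L_2}$ for every finite set $X$ and every $U\subseteq P[X]$. They are semi-isomorphic if there are a ring isomorphism $\mu:L_1\to L_2$ and an automorphism $\sigma$ of the field $P$ such that $\mu(a)=\sigma(a)$ for all $a\in P$ (where $P$ is identified with its images in $L_1$ and $L_2$). They are geometrically equivalent up to a semi-isomorphism if there is an extension $L$ of $P$ that is semi-isomorphic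 to $L_1$ and geometrically equivalent to $L_2$. Then: (1) For any two field extensions $L_1,L_2$ of $P$, the categories $K_P(L_1)$ and $K_P(L_2)$ are isomorphic if and only if $L_1$ and $L_2$ are geometrically equivalent up to a semi-isomorphism. (2) Every automorphism $\varphi$ of the category of polynomial algebras $P[X]$ ($X$ a finite set; morphisms are the homomorphisms of $P$-algebras) is semi-inner: there are an automorphism $\sigma$ of the field $P$ and, for every object $W$, a ring isomorphism $s_W:W\to\varphi(W)$ with $s_W(a)=\sigma(a)$ for all $a\in P$, such that $\varphi(\nu)=s_{W'}\,\nu\,s_W^{-1}$ for every morphism $\nu:W\to W'$. -/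

import Mathlib

open CategoryTheory

namespace UnivAlgGeom

universe u v w

/-- The affine space of points with coordinates in `L`, as the set `Hom (P[X], L)`. -/
abbrev Points (P : Type u) [Field P] (L : Type v) [Field L] [Algebra P L] (X : Type) :
    Type (max u v) :=
  MvPolynomial X P →ₐ[P] L

/-- For a set of points `A`, the ideal `A'`: the intersection of the kernels of the points of `A`
(the whole ring if `A` is empty). -/
noncomputable def idealOf {P : Type u} [Field P] {L : Type v} [Field L] [Algebra P L] {X : Type}
    (A : Set (Points P L X)) : Ideal (MvPolynomial X P) :=
  ⨅ μ ∈ A, RingHom.ker μ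

/-- For a system of equations `U`, the set `U'` of its solutions over `L`:
the points `μ` with `U ⊆ Ker μ`. -/
def solutions {P : Type u} [Field P] (L : Type v) [Field L] [Algebra P L] {X : Type}
    (U : Set (MvPolynomial X P)) : Set (Points P L X) :=
  {μ | U ⊆ (RingHom.ker μ : Set (MvPolynomial X P))}

/-- The `L`-closure `U''` of a system of equations `U`. -/
noncomputable def closureOver {P : Type u} [Field P] (L : Type v) [Field L] [Algebra P L]
    {X : Type} (U : Set (MvPolynomial X P)) : Ideal (MvPolynomial X P) :=
  idealOf (solutions L U)

/-- Geometric equivalence of two extensions of `P`. -/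
def GeomEquivalent (P : Type u) [Field P] (L₁ : Type v) [Field L₁] [Algebra P L₁]
    (L₂ : Type w) [Field L₂] [Algebra P L₂] : Prop :=
  ∀ (X : Type) [Finite X] (U : Set (MvPolynomial X P)), closureOver L₁ U = closureOver L₂ U

/-- Semi-isomorphism of two extensions of `P`: a ring isomorphism that restricts to an
automorphism of `P`. -/
def SemiIsomorphic (P : Type u) [Field P] (L₁ : Type v) [Field L₁] [Algebra P L₁]
    (L₂ : Type w) [Field L₂] [Algebra P L₂] : Prop :=
  ∃ (σ : P ≃+* P) (μ : L₁ ≃+* L₂), ∀ a : P, μ (algebraMap P L₁ a) = algebraMap P L₂ (σ a)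

/-- Geometric equivalence up to a semi-isomorphism: some extension `L` of `P` is
semi-isomorphic to `L₁` and geometrically equivalent to `L₂`. (As `L` is isomorphic to `L₁` as a
ring, it is no restriction to take it in the same universe.) -/
def GeomEquivalentUpToSemiIso (P : Type u) [Field P] (L₁ : Type v) [Field L₁] [Algebra P L₁]
    (L₂ : Type w) [Field L₂] [Algebra P L₂] : Prop :=
  ∃ (L : Type v) (_ : Field L) (_ : Algebra P L),
    SemiIsomorphic P L L₁ ∧ GeomEquivalent P L L₂

/-- An object `(X, A)` of the category of algebraic sets: a finite set of variables `X` and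
an algebraic set `A` in `Hom (P[X], L)`. -/
structure AlgSet (P : Type u) [Field P] (L : Type v) [Field L] [Algebra P L] where
  vars : Type
  finite_vars : Finite vars
  carrier : Set (Points P L vars)
  isAlgebraic : ∃ U : Set (MvPolynomial vars P), carrier = solutions L U

/-- A morphism `(X, A) ⟶ (Y, B)`: a map `A → B` of the form `ν ↦ ν ∘ s` for some
homomorphism of `P`-algebras `s : P[Y] → P[X]`. -/
@[ext]
structure AlgSetHom {P : Type u} [Field P] {L : Type v} [Field L] [Algebra P L]
    (A B : AlgSet P L) where
  toFun : A.carrier → B.carrier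
  isInduced : ∃ s : MvPolynomial B.vars P →ₐ[P] MvPolynomial A.vars P,
    ∀ ν : A.carrier, (toFun ν : Points P L B.vars) = (ν : Points P L A.vars).comp s

/-- The category `K_P(L)` of algebraic sets. -/
noncomputable instance AlgSet.category (P : Type u) [Field P] (L : Type v) [Field L] [Algebra P L] :
    Category (AlgSet P L) where
  Hom A B := AlgSetHom A B
  id A := ⟨id, AlgHom.id P _, fun _ => rfl⟩
  comp {A B C} f g := ⟨g.toFun ∘ f.toFun, by
    obtain ⟨s, hs⟩ := f.isInduced
    obtain ⟨t, ht⟩ := g.isInduced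
    refine ⟨s.comp t, fun ν => ?_⟩
    rw [Function.comp_apply, ht, hs]
    rfl⟩

/-- Two functors inverse to each other on the nose. -/
def MutuallyInverse {C : Type*} [Category C] {D : Type*} [Category D]
    (F : C ⥤ D) (G : D ⥤ C) : Prop :=
  F ⋙ G = 𝟭 C ∧ G ⋙ F = 𝟭 D

/-- Isomorphism (not only equivalence) of categories. -/
def IsomorphicCategories (C : Type*) [Category C] (D : Type*) [Category D] : Prop :=
  ∃ (F : C ⥤ D) (G : D ⥤ C), MutuallyInverse F G

/-- An automorphism of a category. -/
def IsCatAutomorphism {C : Type*} [Category C] (F : C ⥤ C) : Prop :=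
  ∃ G : C ⥤ C, MutuallyInverse F G

/-- An object of the category of polynomial algebras over `P`, representing `P[X]` for a
finite set of variables `X`. -/
structure PolyAlg (P : Type u) [Field P] where
  vars : Type
  finite_vars : Finite vars

/-- The category of polynomial algebras `P[X]`, `X` finite; a morphism from `P[X]` to `P[Y]`
is a homomorphism of `P`-algebras. -/
noncomputable instance PolyAlg.category (P : Type u) [Field P] : Category (PolyAlg P) where
  Hom X Y := MvPolynomial X.vars P →ₐ[P] MvPolynomial Y.vars P
  id X := AlgHom.id P _
  comp f g := g.comp f

/-- The algebra homomorphism underlying a morphism of polynomial algebras. -/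
noncomputable def PolyAlg.toAlgHom {P : Type u} [Field P] {X Y : PolyAlg P} (f : X ⟶ Y) :
    MvPolynomial X.vars P →ₐ[P] MvPolynomial Y.vars P := f

/-- A functor `F` of the category of polynomial algebras to itself is semi-inner if there are an
automorphism `σ` of `P` and ring isomorphisms `s_W : W → F(W)` that restrict to `σ` on
the constants, with `F(ν) = s_{W'} ν s_W⁻¹` for every morphism `ν : W → W'`. -/
def IsSemiInner {P : Type u} [Field P] (F : PolyAlg P ⥤ PolyAlg P) : Prop :=
  ∃ (σ : P ≃+* P)
    (s : ∀ W : PolyAlg P, MvPolynomial W.vars P ≃+* MvPolynomial (F.obj W).vars P),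
    (∀ (W : PolyAlg P) (a : P), s W (MvPolynomial.C a) = MvPolynomial.C (σ a)) ∧
    ∀ (W W' : PolyAlg P) (ν : W ⟶ W') (f : MvPolynomial (F.obj W).vars P),
      PolyAlg.toAlgHom (F.map ν) f = s W' (PolyAlg.toAlgHom ν ((s W).symm f))

end UnivAlgGeom

/-! Morphisms of affine spaces over `L` are homomorphisms of polynomial algebras read backwards
(`affine` is fully faithful, `P` being infinite), and affine spaces are the finite powers of the
line. If an equivalence carries the line to an isomorphic copy of the line, its values on affine
spaces can be identified with affine spaces so that coordinates are preserved and, after an affine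
change of coordinate, the points 0 and 1 as well. What is left is a permutation of `P`, the rational
points of the line, that conjugates polynomial maps to polynomial maps. It is a field automorphism σ
(`exists_ringEquiv_of_conj_affine`), and the equivalence acts on affine spaces by applying σ to
coefficients (`exists_eq_twist`, `exists_twist_iso`). This proves (2), where the line is recognized
by its idempotent endomorphisms.

For algebraic sets, recognizing the line is the hard point. Affine spaces are injective for strict
monomorphisms, so the image of the line is a retract of an affine space, and its coordinate algebra
is a retract of a polynomial algebra. A nonconstant morphism from the line embeds this algebra in
`P[t]`, and `exists_aeval_bijective_of_retract` shows that it is generated by one element. Vanishing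
of a polynomial along a morphism is an equality of two composites, hence categorical; so σ matches
the closure operators (`ClosuresCorrespond`), which is equivalence up to a semi-isomorphism with the
scalars of `L₁` twisted. Conversely, if σ matches the closures, applying it to coefficients is an
isomorphism of categories (`transfer`). -/

namespace UnivAlgGeom

universe u v w

/-! ### Retracts of factorial rings inside `k[X]`; permutations conjugating affine maps -/

section OneVariable

open Polynomial

/-- An irreducible element of a retract of a factorial domain is prime. -/
theorem prime_of_irreducible_of_retract {R S : Type*} [CommRing R] [CommRing S] [IsDomain S]
    [UniqueFactorizationMonoid S] (i : R →+* S) (r : S →+* R) (hr : ∀ x, r (i x) = x)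
    {u : R} (hu : Irreducible u) : Prime u := by
  -- If `r s` is irreducible, `r` sends all prime factors of `s` but one to units; the exceptional
  -- prime has image associated to `r s`.
  have key : ∀ s : S, Irreducible (r s) → ∃ q, Prime q ∧ q ∣ s ∧ r q ∣ r s ∧ r s ∣ r q := by
    intro s
    induction s using UniqueFactorizationMonoid.induction_on_prime with
    | h₁ => intro h; simp at h
    | h₂ x hx => intro h; exact absurd (hx.map r) h.not_isUnit
    | h₃ a p _ hp ih =>
      intro h
      rw [map_mul] at h
      rcases h.isUnit_or_isUnit rfl with h' | h'
      · obtain ⟨q, hq, hqa, h1, h2⟩ := ih ((irreducible_isUnit_mul h').1 h)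
        refine ⟨q, hq, hqa.mul_left p, ?_, ?_⟩
        · rw [map_mul]; exact h1.mul_left _
        · rw [map_mul]; exact (h'.mul_left_dvd).2 h2
      · refine ⟨p, hp, dvd_mul_right _ _, ?_, ?_⟩
        · rw [map_mul]; exact dvd_mul_right _ _
        · rw [map_mul]; exact (h'.mul_right_dvd).2 dvd_rfl
  obtain ⟨q, hq, hqu, -, h2⟩ := key (i u) (by rwa [hr])
  rw [hr] at h2
  have key2 : ∀ a, q ∣ i a → u ∣ a := by
    rintro a ⟨c, hc⟩
    have : a = r q * r c := by rw [← map_mul, ← hc, hr]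
    rw [this]
    exact h2.mul_right _
  refine ⟨hu.ne_zero, hu.not_isUnit, fun a b hab => ?_⟩
  have : q ∣ i a * i b := by
    rw [← map_mul]; exact hqu.trans (map_dvd i hab)
  exact (hq.dvd_or_dvd this).imp (key2 a) (key2 b)

/-- Over a field, every polynomial is integral over the subalgebra generated by a nonconstant
polynomial. -/
theorem isIntegral_aeval_of_natDegree_ne_zero {k : Type*} [Field k] {q : k[X]}
    (hq : q.natDegree ≠ 0) : (aeval q : k[X] →ₐ[k] k[X]).toRingHom.IsIntegral := by
  set φ := (aeval q : k[X] →ₐ[k] k[X]).toRingHom with hφ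
  have hX : φ.IsIntegralElem X := by
    have hq0 : q.leadingCoeff ≠ 0 := by
      rw [leadingCoeff_ne_zero]; rintro rfl; simp at hq
    -- The monic equation of `X` is `q(T) - q = 0` divided by the leading coefficient, the
    -- lower-case `q` in the constant term being the image of the variable.
    refine ⟨(C (q.leadingCoeff⁻¹) * q).map C - C (C q.leadingCoeff⁻¹ * X), ?_, ?_⟩
    · apply Monic.sub_of_left
      · apply Monic.map
        rw [Monic, leadingCoeff_mul, leadingCoeff_C, inv_mul_cancel₀ hq0]
      · refine degree_C_le.trans_lt ?_
        rw [degree_map, degree_C_mul (inv_ne_zero hq0)]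
        exact natDegree_pos_iff_degree_pos.1 (Nat.pos_of_ne_zero hq)
    · have h1 : φ.comp C = C := by ext; simp [hφ]
      rw [eval₂_sub, eval₂_map, h1, eval₂_C, eval₂_C_X]
      simp [hφ]
  intro f
  induction f using Polynomial.induction_on' with
  | add p q hp hq => exact hp.add _ hq
  | monomial n a =>
    rw [← C_mul_X_pow_eq_monomial]
    refine RingHom.IsIntegralElem.mul _ ?_ ?_
    · have : C a = φ (C a) := by simp [hφ]
      rw [this]; exact φ.isIntegralElem_map
    · induction n with
      | zero => rw [pow_zero]; exact φ.isIntegralElem_one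
      | succ n ih => rw [pow_succ]; exact ih.mul _ hX

/-- A subalgebra of `k[X]` other than `k` that is a retract of a factorial algebra is generated
by a single element. -/
theorem exists_aeval_bijective_of_retract {k R S : Type*} [Field k] [CommRing R] [Algebra k R]
    [CommRing S] [IsDomain S] [UniqueFactorizationMonoid S]
    (i : R →+* S) (r : S →+* R) (hr : ∀ x, r (i x) = x)
    (γ : R →ₐ[k] k[X]) (hγ : Function.Injective γ) (hne : ∃ f, (γ f).natDegree ≠ 0) :
    ∃ u : R, Function.Bijective (aeval u : k[X] →ₐ[k] R) := by
  classical
  have hdom : IsDomain R := hγ.isDomain γ.toRingHom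
  have hM : ∃ n, ∃ f : R, f ≠ 0 ∧ (γ f).eval 0 = 0 ∧ (γ f).natDegree = n := by
    obtain ⟨f, hf⟩ := hne
    refine ⟨_, f - algebraMap k R ((γ f).eval 0), ?_, ?_, rfl⟩
    · intro h
      rw [sub_eq_zero] at h
      rw [h, AlgHom.commutes] at hf
      simp at hf
    · simp
  -- The generator is a nonzero element of least degree among those vanishing at 0. In a
  -- factorization one factor vanishes at 0, so by minimality the other has degree 0: `u` is
  -- irreducible.
  obtain ⟨u, hu0, huM, hun⟩ := Nat.find_spec hM
  have hmin : ∀ f : R, f ≠ 0 → (γ f).eval 0 = 0 → (γ u).natDegree ≤ (γ f).natDegree :=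
    fun f h0 h1 => hun ▸ Nat.find_min' hM ⟨f, h0, h1, rfl⟩
  have hγ0 : ∀ f : R, f ≠ 0 → γ f ≠ 0 := fun f h h' => h (hγ (by rw [h', map_zero]))
  have hdeg0 : ∀ f : R, (γ f).natDegree = 0 → f = algebraMap k R ((γ f).eval 0) := by
    intro f hf
    apply hγ
    rw [eq_C_of_natDegree_eq_zero hf, AlgHom.commutes]
    rw [eq_C_of_natDegree_eq_zero hf]
    simp
  have hud : (γ u).natDegree ≠ 0 := by
    intro h
    have := hdeg0 u h
    rw [huM, map_zero] at this
    exact hu0 this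
  have hunit : ∀ f : R, f ≠ 0 → (γ f).natDegree = 0 → IsUnit f := by
    intro f h0 hf
    have h := hdeg0 f hf
    rw [h]
    refine (IsUnit.mk0 _ ?_).map _
    intro h'
    rw [h', map_zero] at h
    exact h0 h
  have hirr : Irreducible u := by
    refine ⟨fun h => ?_, fun a b hab => ?_⟩
    · exact hud (natDegree_eq_zero_of_isUnit (h.map γ))
    · have ha : a ≠ 0 := by rintro rfl; simp [hab] at hu0
      have hb : b ≠ 0 := by rintro rfl; simp [hab] at hu0
      have hd : (γ u).natDegree = (γ a).natDegree + (γ b).natDegree := by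
        rw [hab, map_mul, natDegree_mul (hγ0 a ha) (hγ0 b hb)]
      have h0 : (γ a).eval 0 * (γ b).eval 0 = 0 := by rw [← eval_mul, ← map_mul, ← hab, huM]
      rcases mul_eq_zero.1 h0 with h | h
      · exact Or.inr (hunit b hb (by have := hmin a ha h; omega))
      · exact Or.inl (hunit a ha (by have := hmin b hb h; omega))
  have hprime : Prime u := prime_of_irreducible_of_retract i r hr hirr
  have hcomp : ∀ (f : R) (p : k[X]), γ (aeval f p) = p.comp (γ f) := by
    intro f p
    rw [← aeval_algHom_apply, comp_eq_aeval]
  -- As `γ f` is integral over `k[γ u]`, the class of `f` modulo `u` is algebraic over `k`. Its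
  -- minimal polynomial, evaluated at `f`, lies in `(u)`, so it vanishes at 0; in the domain `R/(u)`
  -- this forces the class of `f` to be 0.
  have hdvd : ∀ f : R, (γ f).eval 0 = 0 → u ∣ f := by
    intro f hf
    have hI : (Ideal.span {u}).IsPrime := (Ideal.span_singleton_prime hu0).2 hprime
    obtain ⟨p, hpm, hp⟩ := isIntegral_aeval_of_natDegree_ne_zero hud (γ f)
    have h1 : (aeval (γ u) : k[X] →ₐ[k] k[X]).toRingHom
        = γ.toRingHom.comp (aeval u : k[X] →ₐ[k] R).toRingHom := by
      ext x <;> simp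
    rw [h1] at hp
    have hp1 : p.eval₂ (aeval u : k[X] →ₐ[k] R).toRingHom f = 0 := by
      apply hγ
      rw [map_zero, ← hp]
      exact hom_eval₂ p (aeval u : k[X] →ₐ[k] R).toRingHom γ.toRingHom f
    set Q := Ideal.Quotient.mk (Ideal.span {u}) with hQ
    have hp2 := congrArg Q hp1
    rw [map_zero, hom_eval₂] at hp2
    have h2 : Q.comp (aeval u : k[X] →ₐ[k] R).toRingHom
        = (algebraMap k (R ⧸ Ideal.span {u})).comp (evalRingHom 0) := by
      ext x
      · simp [hQ]
      · have : Q u = 0 := Ideal.Quotient.eq_zero_iff_mem.2 (Ideal.mem_span_singleton_self u)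
        simp [this]
    rw [h2, ← eval₂_map] at hp2
    have hint : IsIntegral k (Q f) := ⟨_, hpm.map _, hp2⟩
    have hmem : aeval f (minpoly k (Q f)) ∈ Ideal.span {u} := by
      rw [← Ideal.Quotient.eq_zero_iff_mem]
      have := minpoly.aeval k (Q f)
      rw [← this]
      exact (aeval_algHom_apply (Ideal.Quotient.mkₐ k (Ideal.span {u})) f _).symm
    obtain ⟨c, hc⟩ := Ideal.mem_span_singleton.1 hmem
    have h3 : (minpoly k (Q f)).coeff 0 = 0 := by
      have := congrArg (fun x => (γ x).eval 0) hc
      simp only [hcomp, map_mul, eval_mul, huM, zero_mul, eval_comp, hf] at this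
      rw [coeff_zero_eq_eval_zero, this]
    rw [minpoly.coeff_zero_eq_zero hint] at h3
    exact Ideal.mem_span_singleton.1 (Ideal.Quotient.eq_zero_iff_mem.1 h3)
  refine ⟨u, ?_, ?_⟩
  · rw [injective_iff_map_eq_zero]
    intro p hp
    have := hcomp u p
    rw [hp, map_zero, eq_comm, comp_eq_zero_iff] at this
    rcases this with h | ⟨-, h⟩
    · exact h
    · rw [h] at hud; simp at hud
  · intro f
    induction hn : (γ f).natDegree using Nat.strong_induction_on generalizing f with
    | _ n ih =>
      by_cases h0 : n = 0
      · refine ⟨C ((γ f).eval 0), ?_⟩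
        rw [aeval_C, ← hdeg0 f (hn.trans h0)]
      · obtain ⟨g, hg⟩ := hdvd (f - algebraMap k R ((γ f).eval 0)) (by simp)
        rw [sub_eq_iff_eq_add] at hg
        by_cases hg0 : g = 0
        · refine ⟨C ((γ f).eval 0), ?_⟩
          rw [aeval_C]
          conv_rhs => rw [hg, hg0, mul_zero, zero_add]
        · have hd : (γ f).natDegree = (γ u).natDegree + (γ g).natDegree := by
            conv_lhs => rw [hg, map_add, map_mul, AlgHom.commutes, algebraMap_eq, natDegree_add_C]
            rw [natDegree_mul (hγ0 u hu0) (hγ0 g hg0)]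
          obtain ⟨p, hp⟩ := ih (γ g).natDegree (by omega) g rfl
          refine ⟨X * p + C ((γ f).eval 0), ?_⟩
          rw [map_add, map_mul, aeval_X, aeval_C, hp, ← hg]

/-- A permutation of an infinite field fixing `0` and `1` that conjugates affine maps to polynomial
maps is a field automorphism. -/
theorem exists_ringEquiv_of_conj_affine {P : Type*} [Field P] [Infinite P] (τ : P → P)
    (hτ : Function.Bijective τ) (h0 : τ 0 = 0) (h1 : τ 1 = 1)
    (H : ∀ a b : P, ∃ q : P[X], ∀ c, τ (a * c + b) = q.eval (τ c)) :
    ∃ σ : P ≃+* P, ∀ a, σ a = τ a := by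
  -- The conjugate of an invertible affine map is a polynomial map with a polynomial inverse, hence
  -- of degree 1.
  have haff : ∀ a b : P, a ≠ 0 → ∃ m n : P, ∀ c, τ (a * c + b) = m * τ c + n := by
    intro a b ha
    obtain ⟨q, hq⟩ := H a b
    obtain ⟨q', hq'⟩ := H a⁻¹ (-(a⁻¹ * b))
    have hcomp : q'.comp q = X := by
      apply Polynomial.funext
      intro d
      obtain ⟨c, rfl⟩ := hτ.2 d
      rw [eval_comp, ← hq, ← hq', eval_X]
      congr 1
      field_simp
      ring
    have hd : q.natDegree ≤ 1 := by
      have h := congrArg natDegree hcomp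
      rw [natDegree_comp, natDegree_X] at h
      exact (Nat.eq_one_of_mul_eq_one_left h).le
    obtain ⟨m, n, rfl⟩ := exists_eq_X_add_C_of_natDegree_le_one hd
    exact ⟨m, n, fun c => by simp [hq]⟩
  have hmul : ∀ a c, τ (a * c) = τ a * τ c := by
    intro a c
    rcases eq_or_ne a 0 with rfl | ha
    · simp [h0]
    obtain ⟨m, n, h⟩ := haff a 0 ha
    have e0 := h 0
    have e1 := h 1
    have ec := h c
    simp only [mul_zero, add_zero, h0, zero_add, mul_one, h1] at e0 e1 ec
    rw [ec, e1, ← e0, add_zero, add_zero]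
  have hadd : ∀ b c, τ (b + c) = τ b + τ c := by
    intro b c
    rcases eq_or_ne b 0 with rfl | hb
    · simp [h0]
    obtain ⟨m, n, h⟩ := haff 1 b one_ne_zero
    -- A nontrivial translation has no fixed point, so neither has its conjugate; slope other than 1
    -- would produce one.
    have hm : m = 1 := by
      by_contra hm
      have hm' : 1 - m ≠ 0 := sub_ne_zero.2 (Ne.symm hm)
      obtain ⟨d, hd⟩ := hτ.2 (n / (1 - m))
      have e := h d
      have : m * τ d + n = τ d := by rw [hd]; field_simp; ring
      rw [this] at e
      have := hτ.1 e
      simp [hb] at this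
    have e0 := h 0
    have ec := h c
    simp only [one_mul, zero_add, h0, mul_zero, hm] at e0 ec
    rw [e0, add_comm b c, ec, add_comm]
  exact ⟨RingEquiv.ofBijective
    ({ toFun := τ, map_one' := h1, map_mul' := hmul, map_zero' := h0, map_add' := hadd } :
      P →+* P) hτ, fun _ => rfl⟩

end OneVariable

/-! ### Powers of an object, and twists by a field automorphism -/

/-- The family `π` exhibits `Q` as a power of the object `l`. -/
def IsPower {C : Type*} [Category C] {ι : Type} {Q l : C} (π : ι → (Q ⟶ l)) : Prop :=
  ∀ ⦃W : C⦄ (g : ι → (W ⟶ l)), ∃! h : W ⟶ Q, ∀ i, h ≫ π i = g i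

theorem IsPower.hom_ext {C : Type*} [Category C] {ι : Type} {Q l : C} {π : ι → (Q ⟶ l)}
    (h : IsPower π) {W : C} {f g : W ⟶ Q} (hfg : ∀ i, f ≫ π i = g ≫ π i) : f = g :=
  (h fun i => g ≫ π i).unique hfg fun _ => rfl

theorem IsPower.map {C : Type*} [Category C] {D : Type*} [Category D] (F : C ⥤ D) [F.Full]
    [F.Faithful] [F.EssSurj] {ι : Type} {Q l : C} {π : ι → (Q ⟶ l)} (h : IsPower π) :
    IsPower fun i => F.map (π i) := by
  intro W g
  let e := F.objObjPreimageIso W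
  obtain ⟨k, hk, hk'⟩ := h fun i => F.preimage (e.hom ≫ g i)
  refine ⟨e.inv ≫ F.map k, fun i => ?_, fun k' h' => ?_⟩
  · simp only
    rw [Category.assoc, ← F.map_comp, hk]
    simp
  · rw [← hk' (F.preimage (e.hom ≫ k')) ?_]
    · simp
    · intro i
      apply F.map_injective
      simp [← h' i]

theorem IsPower.exists_iso {C : Type*} [Category C] {ι : Type} {Q l Q' l' : C}
    {π : ι → (Q ⟶ l)} {π' : ι → (Q' ⟶ l')} (h : IsPower π) (h' : IsPower π') (e : l ≅ l') :
    ∃ f : Q ≅ Q', ∀ i, f.hom ≫ π' i = π i ≫ e.hom := by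
  obtain ⟨f, hf, -⟩ := h' fun i => π i ≫ e.hom
  obtain ⟨g, hg, -⟩ := h fun i => π' i ≫ e.inv
  exact ⟨⟨f, g, h.hom_ext fun i => by simp [hg, reassoc_of% hf],
    h'.hom_ext fun i => by simp [hf, reassoc_of% hg]⟩, hf⟩

/-- Conjugation of a homomorphism of polynomial algebras by an automorphism of the ground field. -/
noncomputable def twistAlgHom {P : Type*} [Field P] (σ : P ≃+* P) {X Y : Type}
    (s : MvPolynomial X P →ₐ[P] MvPolynomial Y P) : MvPolynomial X P →ₐ[P] MvPolynomial Y P :=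
  MvPolynomial.aeval fun i => MvPolynomial.map (σ : P →+* P) (s (MvPolynomial.X i))

theorem twistAlgHom_map {P : Type*} [Field P] (σ : P ≃+* P) {X Y : Type}
    (s : MvPolynomial X P →ₐ[P] MvPolynomial Y P) (p : MvPolynomial X P) :
    twistAlgHom σ s (MvPolynomial.map (σ : P →+* P) p) = MvPolynomial.map (σ : P →+* P) (s p) := by
  induction p using MvPolynomial.induction_on with
  | C c =>
    rw [MvPolynomial.map_C, MvPolynomial.algHom_C, MvPolynomial.algHom_C,
      MvPolynomial.algebraMap_eq, MvPolynomial.map_C]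
  | add p q hp hq => simp [hp, hq]
  | mul_X p i hp => rw [map_mul, map_mul, hp]; simp [twistAlgHom]

/-! ### Polynomial algebras: points, coordinates and rigidity up to a twist -/

namespace PolyAlg

variable {P : Type u} [Field P]

/-- The polynomial algebra in one variable. -/
def line (P : Type u) [Field P] : PolyAlg P := ⟨Unit, inferInstance⟩

instance : Unique (line P).vars := inferInstanceAs (Unique Unit)

/-- The polynomial algebra in no variables. -/
def pt (P : Type u) [Field P] : PolyAlg P := ⟨Empty, inferInstance⟩

instance : IsEmpty (pt P).vars := inferInstanceAs (IsEmpty Empty)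

/-- The morphism given by the images of the variables. -/
noncomputable def ofVars {X Y : PolyAlg P} (f : X.vars → MvPolynomial Y.vars P) : X ⟶ Y :=
  (MvPolynomial.aeval f : MvPolynomial X.vars P →ₐ[P] MvPolynomial Y.vars P)

/-- The morphism from the line that picks an element. -/
noncomputable def elem (X : PolyAlg P) (p : MvPolynomial X.vars P) : line P ⟶ X :=
  ofVars fun _ => p

/-- The coordinate morphisms. -/
noncomputable def coord (X : PolyAlg P) (i : X.vars) : line P ⟶ X := elem X (MvPolynomial.X i)

/-- The morphism of evaluation at a point. -/
noncomputable def point (X : PolyAlg P) (a : X.vars → P) : X ⟶ pt P :=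
  ofVars fun i => MvPolynomial.C (a i)

theorem hom_ext {X Y : PolyAlg P} {f g : X ⟶ Y}
    (h : ∀ i, toAlgHom f (MvPolynomial.X i) = toAlgHom g (MvPolynomial.X i)) : f = g :=
  MvPolynomial.algHom_ext h

theorem line_hom_ext {X : PolyAlg P} {f g : line P ⟶ X}
    (h : toAlgHom f (MvPolynomial.X default) = toAlgHom g (MvPolynomial.X default)) : f = g :=
  hom_ext fun i => by rw [Unique.eq_default i]; exact h

@[simp]
theorem toAlgHom_id (X : PolyAlg P) (p : MvPolynomial X.vars P) : toAlgHom (𝟙 X) p = p := rfl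

@[simp]
theorem toAlgHom_comp {X Y Z : PolyAlg P} (f : X ⟶ Y) (g : Y ⟶ Z) (p : MvPolynomial X.vars P) :
    toAlgHom (f ≫ g) p = toAlgHom g (toAlgHom f p) := rfl

@[simp]
theorem toAlgHom_ofVars_X {X Y : PolyAlg P} (f : X.vars → MvPolynomial Y.vars P) (i : X.vars) :
    toAlgHom (ofVars f : X ⟶ Y) (MvPolynomial.X i) = f i :=
  MvPolynomial.aeval_X _ _

@[simp]
theorem toAlgHom_elem_X (X : PolyAlg P) (p : MvPolynomial X.vars P) (i : (line P).vars) :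
    toAlgHom (elem X p) (MvPolynomial.X i) = p := toAlgHom_ofVars_X _ _

@[simp]
theorem toAlgHom_coord_X (X : PolyAlg P) (i : X.vars) (j : (line P).vars) :
    toAlgHom (coord X i) (MvPolynomial.X j) = MvPolynomial.X i := toAlgHom_ofVars_X _ _

@[simp]
theorem toAlgHom_point (X : PolyAlg P) (a : X.vars → P) (p : MvPolynomial X.vars P) :
    toAlgHom (point X a) p = MvPolynomial.C (MvPolynomial.eval a p) := by
  induction p using MvPolynomial.induction_on with
  | C c => rw [MvPolynomial.eval_C]; exact (toAlgHom (point X a)).commutes c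
  | add p q hp hq => simp [hp, hq]
  | mul_X p i hp => rw [map_mul, hp]; simp [point]

theorem exists_eq_point {X : PolyAlg P} (f : X ⟶ pt P) : ∃ a, f = point X a := by
  refine ⟨fun i => MvPolynomial.eval (isEmptyElim) (toAlgHom f (MvPolynomial.X i)), ?_⟩
  refine hom_ext fun i => ?_
  rw [toAlgHom_point, MvPolynomial.eval_X, MvPolynomial.eq_C_of_isEmpty (toAlgHom f _)]
  simp

theorem point_injective {X : PolyAlg P} : Function.Injective (point X) := by
  intro a b h
  funext i
  have := congrArg (fun f => toAlgHom f (MvPolynomial.X i)) h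
  simpa using this

theorem comp_point {X Y : PolyAlg P} (f : X ⟶ Y) (a : Y.vars → P) :
    f ≫ point Y a
      = point X fun i => MvPolynomial.eval a (toAlgHom f (MvPolynomial.X i)) :=
  hom_ext fun i => by simp

theorem coord_line : coord (line P) default = 𝟙 _ := line_hom_ext (by simp)

/-- Conjugation of a morphism by an automorphism of the ground field. -/
noncomputable def twist (σ : P ≃+* P) {X Y : PolyAlg P} (f : X ⟶ Y) : X ⟶ Y :=
  twistAlgHom σ (toAlgHom f)

theorem toAlgHom_twist_map (σ : P ≃+* P) {X Y : PolyAlg P} (f : X ⟶ Y)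
    (p : MvPolynomial X.vars P) :
    toAlgHom (twist σ f) (MvPolynomial.map (σ : P →+* P) p)
      = MvPolynomial.map (σ : P →+* P) (toAlgHom f p) :=
  twistAlgHom_map σ _ p

/-- A functorial family of bijections of the sets of morphisms that fixes the coordinates, the
points `0` and `1` of the line is the twist by an automorphism of the ground field. -/
theorem exists_eq_twist [Infinite P] (Φ : ∀ X Y : PolyAlg P, (X ⟶ Y) → (X ⟶ Y))
    (hcomp : ∀ X Y Z (f : X ⟶ Y) (g : Y ⟶ Z), Φ X Z (f ≫ g) = Φ X Y f ≫ Φ Y Z g)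
    (hbij : ∀ X Y, Function.Bijective (Φ X Y))
    (hcoord : ∀ X i, Φ _ _ (coord X i) = coord X i)
    (h0 : Φ _ _ (point (line P) 0) = point (line P) 0)
    (h1 : Φ _ _ (point (line P) 1) = point (line P) 1) :
    ∃ σ : P ≃+* P, ∀ X Y (f : X ⟶ Y), Φ X Y f = twist σ f := by
  have hex : ∀ c : P, ∃ d : P, Φ _ _ (point (line P) fun _ => c) = point (line P) fun _ => d := by
    intro c
    obtain ⟨a, ha⟩ := exists_eq_point (Φ _ _ (point (line P) fun _ => c))
    exact ⟨a default, ha⟩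
  choose τ hτ using hex
  have hτbij : Function.Bijective τ := by
    constructor
    · intro a b hab
      have := (hbij _ _).1 ((hτ a).trans ((congrArg (fun x => point (line P) fun _ => x) hab).trans
        (hτ b).symm))
      exact congrFun (point_injective this) ()
    · intro d
      obtain ⟨f, hf⟩ := (hbij _ _).2 (point (line P) fun _ => d)
      obtain ⟨a, rfl⟩ := exists_eq_point f
      have := (hτ (a default)).symm.trans hf
      exact ⟨a default, congrFun (point_injective this) ()⟩
  have hpoint : ∀ X (a : X.vars → P), Φ _ _ (point X a) = point X fun i => τ (a i) := by
    intro X a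
    obtain ⟨b, hb⟩ := exists_eq_point (Φ _ _ (point X a))
    rw [hb]
    congr 1
    funext i
    have h := hcomp _ _ _ (coord X i) (point X a)
    rw [hcoord, hb, comp_point, comp_point] at h
    simp only [toAlgHom_coord_X, MvPolynomial.eval_X] at h
    rw [hτ] at h
    exact (congrFun (point_injective h) default).symm
  -- Composing `f` with a point evaluates it, so functoriality says that `Φ f` is `f` conjugated by
  -- `τ` as a map on rational points.
  have heval : ∀ X Y (f : X ⟶ Y) (a : Y.vars → P) (i : X.vars),
      τ (MvPolynomial.eval a (toAlgHom f (MvPolynomial.X i)))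
        = MvPolynomial.eval (fun j => τ (a j)) (toAlgHom (Φ X Y f) (MvPolynomial.X i)) := by
    intro X Y f a i
    have h := hcomp _ _ _ f (point Y a)
    rw [comp_point, hpoint, hpoint, comp_point] at h
    exact congrFun (point_injective h) i
  obtain ⟨σ, hσ⟩ := exists_ringEquiv_of_conj_affine τ hτbij
    (congrFun (point_injective ((hτ 0).symm.trans h0)) default)
    (congrFun (point_injective ((hτ 1).symm.trans h1)) default) (by
      intro a b
      refine ⟨MvPolynomial.uniqueAlgEquiv P (line P).vars (toAlgHom (Φ _ _ (elem (line P)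
        (MvPolynomial.C a * MvPolynomial.X default + MvPolynomial.C b))) (MvPolynomial.X default)), ?_⟩
      intro c
      have h := heval _ _ (elem (line P)
        (MvPolynomial.C a * MvPolynomial.X default + MvPolynomial.C b)) (fun _ => c) default
      simp only [toAlgHom_elem_X, map_add, map_mul, MvPolynomial.eval_C, MvPolynomial.eval_X] at h
      rw [h, Polynomial.eval, MvPolynomial.eval₂_const_uniqueAlgEquiv]
      rfl)
  refine ⟨σ, fun X Y f => hom_ext fun i => ?_⟩
  have hi : toAlgHom (twist σ f) (MvPolynomial.X i)
      = MvPolynomial.map (σ : P →+* P) (toAlgHom f (MvPolynomial.X i)) :=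
    MvPolynomial.aeval_X _ _
  rw [hi]
  -- Over an infinite field it is enough to compare values, and every point has the form `τ ∘ a`.
  apply MvPolynomial.funext
  intro b
  obtain ⟨a, rfl⟩ : ∃ a : Y.vars → P, b = fun j => τ (a j) := by
    choose a ha using fun j => hτbij.2 (b j)
    exact ⟨a, funext fun j => (ha j).symm⟩
  rw [← heval, ← hσ]
  have : (fun j => τ (a j)) = (σ : P →+* P) ∘ a := funext fun j => (hσ _).symm
  rw [this, MvPolynomial.eval_map]
  exact MvPolynomial.eval₂_comp (σ : P →+* P) a _

/-- An affine change of the coordinate on the line. -/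
theorem exists_iso_line {a b : P} (hab : a ≠ b) :
    ∃ θ : line P ≅ line P, θ.hom ≫ point (line P) (fun _ => a) = point (line P) 0 ∧
      θ.hom ≫ point (line P) (fun _ => b) = point (line P) 1 := by
  have h : b - a ≠ 0 := sub_ne_zero.2 hab.symm
  refine ⟨⟨elem (line P) (MvPolynomial.C (b - a)⁻¹ * (MvPolynomial.X default - MvPolynomial.C a)),
    elem (line P) (MvPolynomial.C (b - a) * MvPolynomial.X default + MvPolynomial.C a), ?_, ?_⟩, ?_, ?_⟩
  · refine line_hom_ext ?_
    simp only [toAlgHom_comp, toAlgHom_elem_X, map_mul, map_sub, toAlgHom_id, MvPolynomial.algHom_C,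
      MvPolynomial.algebraMap_eq, add_sub_cancel_right]
    rw [← map_sub, ← mul_assoc, ← map_mul, inv_mul_cancel₀ h, map_one, one_mul]
  · refine line_hom_ext ?_
    simp only [toAlgHom_comp, toAlgHom_elem_X, map_mul, map_add, toAlgHom_id, MvPolynomial.algHom_C,
      MvPolynomial.algebraMap_eq]
    rw [← mul_assoc, ← map_mul, mul_inv_cancel₀ h, map_one, one_mul, sub_add_cancel]
  · rw [comp_point]
    congr 1
    funext i
    simp
  · rw [comp_point]
    congr 1
    funext i
    simp [h]

/-- The opposites of the coordinate morphisms. -/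
noncomputable abbrev coordOp (X : PolyAlg P) (i : X.vars) : Opposite.op X ⟶ Opposite.op (line P) :=
  (coord X i).op

theorem isPower_coordOp (X : PolyAlg P) : IsPower (coordOp X) := by
  intro W g
  refine ⟨(ofVars fun i => toAlgHom (g i).unop (MvPolynomial.X default) : X ⟶ W.unop).op, ?_, ?_⟩
  · intro i
    apply Quiver.Hom.unop_inj
    exact line_hom_ext (by simp)
  · intro h hh
    apply Quiver.Hom.unop_inj
    refine hom_ext fun i => ?_
    simp [← hh]

/-- Two realizations of the affine spaces as powers of isomorphic lines differ by a twist. -/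
theorem exists_twist_iso [Infinite P] {C : Type*} [Category C] (T₁ T₂ : (PolyAlg P)ᵒᵖ ⥤ C)
    [T₁.Full] [T₁.Faithful] [T₂.Full] [T₂.Faithful]
    (hT₁ : ∀ X : PolyAlg P, IsPower fun i => T₁.map (coordOp X i))
    (hT₂ : ∀ X : PolyAlg P, IsPower fun i => T₂.map (coordOp X i))
    (hl : Nonempty (T₁.obj (Opposite.op (line P)) ≅ T₂.obj (Opposite.op (line P)))) :
    ∃ (σ : P ≃+* P) (e : ∀ X : PolyAlg P, T₁.obj (Opposite.op X) ≅ T₂.obj (Opposite.op X)),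
      ∀ (X Y : PolyAlg P) (f : X ⟶ Y),
        T₁.map f.op ≫ (e X).hom = (e Y).hom ≫ T₂.map (twist σ f).op := by
  obtain ⟨l⟩ := hl
  obtain ⟨p, -⟩ := (hT₁ (pt P)).exists_iso (hT₂ (pt P)) l
  have key : ∀ c : P, ∃ d : P, T₁.map (point (line P) fun _ => c).op ≫ l.hom
      = p.hom ≫ T₂.map (point (line P) fun _ => d).op := by
    intro c
    obtain ⟨g, hg⟩ := T₂.map_surjective (p.inv ≫ T₁.map (point (line P) fun _ => c).op ≫ l.hom)
    obtain ⟨d, hd⟩ := exists_eq_point g.unop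
    refine ⟨d default, ?_⟩
    have : (point (line P) fun _ => d default).op = g := Quiver.Hom.unop_inj hd.symm
    rw [this, hg]
    simp
  obtain ⟨a, ha⟩ := key 0
  obtain ⟨b, hb⟩ := key 1
  have hab : a ≠ b := by
    rintro rfl
    have := ha.trans hb.symm
    rw [cancel_mono] at this
    have := point_injective (Quiver.Hom.op_inj (T₁.map_injective this))
    exact zero_ne_one (congrFun this default)
  obtain ⟨θ, hθ0, hθ1⟩ := exists_iso_line hab
  -- The given isomorphism of lines sends 0 and 1 to distinct points `a` and `b`; the affine
  -- correction brings them back to 0 and 1.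
  let l' := l ≪≫ T₂.mapIso θ.op
  choose e he using fun X => (hT₁ X).exists_iso (hT₂ X) l'
  have hline : (e (line P)).hom = l'.hom := by
    have := he (line P) default
    simpa [coordOp, coord_line] using this
  -- The empty power is a terminal object.
  have hpt : (e (pt P)).hom = p.hom := (hT₂ (pt P)).hom_ext isEmptyElim
  let Φ : ∀ X Y : PolyAlg P, (X ⟶ Y) → (X ⟶ Y) := fun X Y f =>
    (T₂.preimage ((e Y).inv ≫ T₁.map f.op ≫ (e X).hom)).unop
  have hΦ : ∀ X Y (f : X ⟶ Y), T₁.map f.op ≫ (e X).hom = (e Y).hom ≫ T₂.map (Φ X Y f).op := by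
    intro X Y f
    simp [Φ]
  have huniq : ∀ X Y (f g : X ⟶ Y), T₁.map f.op ≫ (e X).hom = (e Y).hom ≫ T₂.map g.op →
      Φ X Y f = g := by
    intro X Y f g h
    rw [hΦ, cancel_epi] at h
    exact Quiver.Hom.op_inj (T₂.map_injective h)
  obtain ⟨σ, hσ⟩ := exists_eq_twist Φ
    (fun X Y Z f g => huniq _ _ _ _ (by
      rw [op_comp, op_comp, T₁.map_comp, T₂.map_comp, Category.assoc, hΦ X Y f,
        ← Category.assoc, hΦ Y Z g, Category.assoc]))
    (fun X Y => ⟨fun f g h => by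
        have h2 := hΦ X Y f
        rw [h, ← hΦ X Y g, cancel_mono] at h2
        exact Quiver.Hom.op_inj (T₁.map_injective h2),
      fun g => ⟨(T₁.preimage ((e Y).hom ≫ T₂.map g.op ≫ (e X).inv)).unop,
        huniq _ _ _ _ (by simp)⟩⟩)
    (fun X i => huniq _ _ _ _ (by rw [hline]; exact (he X i).symm))
    (huniq _ _ _ _ (by
      rw [hline, hpt]
      conv_rhs => rw [← hθ0, op_comp, T₂.map_comp, ← Category.assoc]
      exact (Category.assoc _ _ _).symm.trans (congrArg (fun z => z ≫ T₂.map θ.hom.op) ha)))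
    (huniq _ _ _ _ (by
      rw [hline, hpt]
      conv_rhs => rw [← hθ1, op_comp, T₂.map_comp, ← Category.assoc]
      exact (Category.assoc _ _ _).symm.trans (congrArg (fun z => z ≫ T₂.map θ.hom.op) hb)))
  exact ⟨σ, e, fun X Y f => by rw [← hσ]; exact hΦ X Y f⟩

end PolyAlg

theorem MutuallyInverse.isEquivalence {C : Type*} [Category C] {D : Type*} [Category D]
    {F : C ⥤ D} {G : D ⥤ C} (h : MutuallyInverse F G) : F.IsEquivalence :=
  Functor.IsEquivalence.mk' G (eqToIso h.1.symm) (eqToIso h.2)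

/-! ### Recognizing the line by idempotents; semi-inner automorphisms -/

namespace PolyAlg

variable {P : Type u} [Field P]

/-- The one-variable polynomial that defines an endomorphism of the line. -/
noncomputable def toPoly (f : line P ⟶ line P) : Polynomial P :=
  MvPolynomial.uniqueAlgEquiv P (line P).vars (toAlgHom f (MvPolynomial.X default))

theorem uniqueAlgEquiv_toAlgHom (g : line P ⟶ line P) (p : MvPolynomial (line P).vars P) :
    MvPolynomial.uniqueAlgEquiv P (line P).vars (toAlgHom g p)
      = (MvPolynomial.uniqueAlgEquiv P (line P).vars p).comp (toPoly g) := by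
  have : (MvPolynomial.uniqueAlgEquiv P (line P).vars).toAlgHom.comp (toAlgHom g)
      = (Polynomial.aeval (toPoly g)).comp
        (MvPolynomial.uniqueAlgEquiv P (line P).vars).toAlgHom := by
    refine MvPolynomial.algHom_ext fun i => ?_
    rw [Unique.eq_default i]
    simp [toPoly]
  exact congrArg (fun φ => φ p) this

theorem toPoly_comp (f g : line P ⟶ line P) : toPoly (f ≫ g) = (toPoly f).comp (toPoly g) := by
  rw [toPoly, toAlgHom_comp, uniqueAlgEquiv_toAlgHom]
  rfl

theorem toPoly_id : toPoly (𝟙 (line P)) = Polynomial.X := by simp [toPoly]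

theorem toPoly_injective : Function.Injective (toPoly (P := P)) := fun _ _ h =>
  line_hom_ext ((MvPolynomial.uniqueAlgEquiv P (line P).vars).injective h)

/-- The idempotents of the line are the identity and the constants. -/
theorem idempotent_line (e : line P ⟶ line P) (he : e ≫ e = e) :
    e = 𝟙 _ ∨ ∀ f : line P ⟶ line P, e ≫ f = e := by
  have h := congrArg toPoly he
  rw [toPoly_comp] at h
  have h2 : (toPoly e - Polynomial.X).comp (toPoly e) = 0 := by
    rw [Polynomial.sub_comp, h, Polynomial.X_comp, sub_self]
  rw [Polynomial.comp_eq_zero_iff, sub_eq_zero] at h2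
  rcases h2 with h2 | ⟨-, h2⟩
  · exact Or.inl (toPoly_injective (h2.trans toPoly_id.symm))
  · right
    intro f
    apply toPoly_injective
    rw [toPoly_comp, h2, Polynomial.C_comp]

/-- Without variables the identity is the only endomorphism; with two or more, keeping one variable
and killing the others is an idempotent that is neither the identity nor constant. So there is
exactly one variable. -/
theorem nonempty_iso_line {W : PolyAlg P}
    (h : ∀ e : W ⟶ W, e ≫ e = e → e = 𝟙 _ ∨ ∀ f : W ⟶ W, e ≫ f = e)
    (hW : ∃ e : W ⟶ W, e ≠ 𝟙 W) : Nonempty (line P ≅ W) := by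
  classical
  obtain ⟨e, he⟩ := hW
  have hne : Nonempty W.vars := by
    by_contra hn
    rw [not_nonempty_iff] at hn
    exact he (hom_ext isEmptyElim)
  obtain ⟨i⟩ := hne
  have hsub : ∀ j, j = i := by
    intro j
    by_contra hj
    let e : W ⟶ W := ofVars fun k => if k = i then MvPolynomial.X i else 0
    have hee : e ≫ e = e := by
      refine hom_ext fun k => ?_
      by_cases hk : k = i <;> simp [e, hk]
    rcases h e hee with h1 | h1
    · have := congrArg (fun f => toAlgHom f (MvPolynomial.X j)) h1
      simp only [e, toAlgHom_ofVars_X, hj, if_false, toAlgHom_id] at this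
      exact MvPolynomial.X_ne_zero j this.symm
    · have := congrArg (fun f => toAlgHom f (MvPolynomial.X i)) (h1 (ofVars fun _ => 0))
      simp only [e, toAlgHom_comp, toAlgHom_ofVars_X, if_true] at this
      exact MvPolynomial.X_ne_zero i this.symm
  exact ⟨⟨elem W (MvPolynomial.X i), ofVars fun _ => MvPolynomial.X default,
    line_hom_ext (by simp), hom_ext fun k => by simp [hsub k]⟩⟩

theorem nonempty_iso_map_line (F : PolyAlg P ⥤ PolyAlg P) [F.Full] [F.Faithful] :
    Nonempty (line P ≅ F.obj (line P)) := by
  refine nonempty_iso_line (fun e he => ?_) ⟨F.map (elem _ 0), fun h => ?_⟩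
  · obtain ⟨e, rfl⟩ := F.map_surjective e
    rw [← F.map_comp] at he
    rcases idempotent_line e (F.map_injective he) with rfl | h
    · exact Or.inl (F.map_id _)
    · right
      intro f
      obtain ⟨f, rfl⟩ := F.map_surjective f
      rw [← F.map_comp, h]
  · rw [← F.map_id] at h
    have := congrArg (fun f => toAlgHom f (MvPolynomial.X default)) (F.map_injective h)
    simp only [toAlgHom_elem_X, toAlgHom_id] at this
    exact MvPolynomial.X_ne_zero _ this.symm

/-- An isomorphism of polynomial algebras as an algebra isomorphism. -/
noncomputable def isoToAlgEquiv {X Y : PolyAlg P} (e : X ≅ Y) :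
    MvPolynomial X.vars P ≃ₐ[P] MvPolynomial Y.vars P :=
  AlgEquiv.ofAlgHom (toAlgHom e.hom) (toAlgHom e.inv) (congrArg toAlgHom e.inv_hom_id)
    (congrArg toAlgHom e.hom_inv_id)

/-- Automorphisms of the category of polynomial algebras are semi-inner. -/
theorem isSemiInner [Infinite P] (F : PolyAlg P ⥤ PolyAlg P) (hF : IsCatAutomorphism F) :
    IsSemiInner F := by
  obtain ⟨G, hG⟩ := hF
  have := hG.isEquivalence
  obtain ⟨l⟩ := nonempty_iso_map_line F
  obtain ⟨σ, e, he⟩ := exists_twist_iso F.op (𝟭 _)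
    (fun X => (isPower_coordOp X).map F.op) isPower_coordOp ⟨l.op⟩
  let s : ∀ W : PolyAlg P, MvPolynomial W.vars P ≃+* MvPolynomial (F.obj W).vars P := fun W =>
    (MvPolynomial.mapEquiv W.vars σ).trans (isoToAlgEquiv (e W).unop).toRingEquiv
  have hs : ∀ W p, s W p
      = toAlgHom (e W).hom.unop (MvPolynomial.map (σ : P →+* P) p) := fun _ _ => rfl
  refine ⟨σ, s, fun W a => ?_, fun W W' ν f => ?_⟩
  · rw [hs, MvPolynomial.map_C]
    exact (toAlgHom (e W).hom.unop).commutes _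
  · obtain ⟨q, rfl⟩ := (s W).surjective f
    rw [RingEquiv.symm_apply_apply, hs, hs, ← toAlgHom_twist_map]
    exact congrArg (fun g => toAlgHom g (MvPolynomial.map (σ : P →+* P) q))
      (congrArg Quiver.Hom.unop (he W W' ν))

end PolyAlg

/-! ### Closure operators and semi-isomorphisms -/

section Closure

variable {P : Type u} [Field P] {L : Type v} [Field L] [Algebra P L] {X : Type}

theorem mem_idealOf {A : Set (Points P L X)} {p : MvPolynomial X P} :
    p ∈ idealOf A ↔ ∀ μ ∈ A, μ p = 0 := by
  simp [idealOf, RingHom.mem_ker]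

theorem mem_solutions {U : Set (MvPolynomial X P)} {μ : Points P L X} :
    μ ∈ solutions L U ↔ ∀ p ∈ U, μ p = 0 := Iff.rfl

theorem mem_closureOver {U : Set (MvPolynomial X P)} {p : MvPolynomial X P} :
    p ∈ closureOver L U ↔ ∀ μ : Points P L X, (∀ q ∈ U, μ q = 0) → μ p = 0 := mem_idealOf

theorem subset_closureOver (U : Set (MvPolynomial X P)) : U ⊆ closureOver L U :=
  fun p hp => mem_closureOver.2 fun _ hμ => hμ p hp

theorem solutions_idealOf_solutions (U : Set (MvPolynomial X P)) :
    solutions L (idealOf (solutions L U) : Set (MvPolynomial X P)) = solutions L U := by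
  ext μ
  refine ⟨fun h p hp => h (subset_closureOver U hp), fun h p hp => ?_⟩
  exact mem_idealOf.1 hp μ h

/-- The closure operators of two extensions correspond under an automorphism of `P`. -/
def ClosuresCorrespond (P : Type u) [Field P] (σ : P ≃+* P) (L₁ : Type v) [Field L₁]
    [Algebra P L₁] (L₂ : Type w) [Field L₂] [Algebra P L₂] : Prop :=
  ∀ (X : Type) [Finite X] (U : Set (MvPolynomial X P)) (p : MvPolynomial X P),
    MvPolynomial.map (σ : P →+* P) p ∈ closureOver L₂ (MvPolynomial.map (σ : P →+* P) '' U) ↔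
      p ∈ closureOver L₁ U

end Closure

theorem map_symm_map {P : Type u} [Field P] (σ : P ≃+* P) {X : Type} (p : MvPolynomial X P) :
    MvPolynomial.map (σ : P →+* P) (MvPolynomial.map (σ.symm : P →+* P) p) = p := by
  rw [MvPolynomial.map_map]
  have : (σ : P →+* P).comp (σ.symm : P →+* P) = RingHom.id P := by ext; simp
  rw [this, MvPolynomial.map_id]

section SemiIso

variable {P : Type u} [Field P] {L₁ : Type v} [Field L₁] [Algebra P L₁] {L₂ : Type w} [Field L₂]
  [Algebra P L₂]

theorem semilinear_apply {σ : P ≃+* P} {μ : L₁ ≃+* L₂}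
    (h : ∀ a : P, μ (algebraMap P L₁ a) = algebraMap P L₂ (σ a)) {X : Type} {ν₁ : Points P L₁ X}
    {ν₂ : Points P L₂ X} (hν : ∀ i, μ (ν₁ (MvPolynomial.X i)) = ν₂ (MvPolynomial.X i))
    (p : MvPolynomial X P) : ν₂ (MvPolynomial.map (σ : P →+* P) p) = μ (ν₁ p) := by
  induction p using MvPolynomial.induction_on with
  | C c => rw [MvPolynomial.map_C, MvPolynomial.algHom_C, MvPolynomial.algHom_C, h]; rfl
  | add p q hp hq => simp [hp, hq]
  | mul_X p i hp => rw [map_mul, map_mul, map_mul, map_mul, hp, MvPolynomial.map_X, hν]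

/-- Composition with `μ` on the values of the variables matches the solutions of a system over `L₁`
with those of the σ-twisted system over `L₂`. -/
theorem closuresCorrespond_of_semilinear {σ : P ≃+* P} {μ : L₁ ≃+* L₂}
    (h : ∀ a : P, μ (algebraMap P L₁ a) = algebraMap P L₂ (σ a)) :
    ClosuresCorrespond P σ L₁ L₂ := by
  intro X _ U p
  rw [mem_closureOver, mem_closureOver]
  constructor
  · intro hp ν hν
    have key := semilinear_apply h (ν₁ := ν)
      (ν₂ := MvPolynomial.aeval fun i => μ (ν (MvPolynomial.X i))) (fun i => by simp)
    have := hp _ (by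
      rintro _ ⟨q, hq, rfl⟩
      rw [key, hν q hq, map_zero])
    rw [key] at this
    exact μ.map_eq_zero_iff.1 this
  · intro hp ν hν
    have key := semilinear_apply h (ν₂ := ν)
      (ν₁ := MvPolynomial.aeval fun i => μ.symm (ν (MvPolynomial.X i))) (fun i => by simp)
    rw [key, hp _ fun q hq => ?_, map_zero]
    rw [← μ.map_eq_zero_iff, ← key]
    exact hν _ ⟨q, hq, rfl⟩

/-- The extension `L` of `P` with the scalars twisted by an automorphism of `P`. -/
def Twisted (_σ : P ≃+* P) (L : Type v) : Type v := L

instance (σ : P ≃+* P) : Field (Twisted σ L₁) := inferInstanceAs (Field L₁)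

noncomputable instance (σ : P ≃+* P) : Algebra P (Twisted σ L₁) :=
  ((algebraMap P L₁).comp (σ : P →+* P)).toAlgebra

/-- The identity of `L` as a semi-isomorphism. -/
def Twisted.ringEquiv (σ : P ≃+* P) (L : Type v) [Field L] : Twisted σ L ≃+* L := RingEquiv.refl L

theorem image_map_image_map_symm (σ : P ≃+* P) {X : Type} (U : Set (MvPolynomial X P)) :
    MvPolynomial.map (σ : P →+* P) '' (MvPolynomial.map (σ.symm : P →+* P) '' U) = U := by
  rw [Set.image_image]
  simp [map_symm_map]

/-- Given σ, the required extension is `L₁` with scalars acting through `σ⁻¹`; given the extension,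
its semi-isomorphism with `L₁` supplies the automorphism. -/
theorem geomEquivalentUpToSemiIso_iff :
    GeomEquivalentUpToSemiIso P L₁ L₂ ↔ ∃ σ : P ≃+* P, ClosuresCorrespond P σ L₁ L₂ := by
  constructor
  · rintro ⟨L, _, _, ⟨σ, μ, h⟩, hL⟩
    refine ⟨σ.symm, fun X _ U p => ?_⟩
    rw [← hL, ← closuresCorrespond_of_semilinear h, map_symm_map, image_map_image_map_symm]
  · rintro ⟨σ, h⟩
    have h' : ∀ a : P, Twisted.ringEquiv σ.symm L₁
        (algebraMap P (Twisted σ.symm L₁) a) = algebraMap P L₁ (σ.symm a) := fun a => rfl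
    refine ⟨Twisted σ.symm L₁, inferInstance, inferInstance, ⟨σ.symm, _, h'⟩, ?_⟩
    intro X _ U
    ext p
    refine (closuresCorrespond_of_semilinear h' X U p).symm.trans ?_
    rw [← h, map_symm_map, image_map_image_map_symm]

end SemiIso

/-! ### From corresponding closures to isomorphic categories -/

/-- A fully faithful functor that is bijective on objects is an isomorphism of categories. -/
theorem isomorphicCategories_of_bijective {C : Type*} [Category C] {D : Type*} [Category D]
    (F : C ⥤ D) [F.Full] [F.Faithful] (hF : Function.Bijective F.obj) :
    IsomorphicCategories C D := by
  let e := Equiv.ofBijective F.obj hF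
  have he : ∀ Y, F.obj (e.symm Y) = Y := e.apply_symm_apply
  have he' : ∀ X, e.symm (F.obj X) = X := e.symm_apply_apply
  let G : D ⥤ C :=
    { obj := e.symm
      map := fun {X Y} f => F.preimage (eqToHom (he X) ≫ f ≫ eqToHom (he Y).symm)
      map_id := fun X => F.map_injective (by simp)
      map_comp := fun f g => F.map_injective (by simp) }
  refine ⟨F, G, ?_, ?_⟩
  · refine CategoryTheory.Functor.ext he' fun X Y f => F.map_injective ?_
    simp [G, eqToHom_map]
  · refine CategoryTheory.Functor.ext he fun X Y f => ?_
    simp [G]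

namespace AlgSet

attribute [instance] AlgSet.finite_vars

variable {P : Type u} [Field P] {L : Type v} [Field L] [Algebra P L]

theorem carrier_eq (A : AlgSet P L) :
    A.carrier = solutions L (idealOf A.carrier : Set (MvPolynomial A.vars P)) := by
  obtain ⟨U, hU⟩ := A.isAlgebraic
  rw [hU, solutions_idealOf_solutions]

theorem closureOver_idealOf (A : AlgSet P L) :
    closureOver L (idealOf A.carrier : Set (MvPolynomial A.vars P)) = idealOf A.carrier := by
  rw [closureOver, ← carrier_eq]

/-- The morphism of algebraic sets induced by a homomorphism of polynomial algebras. -/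
noncomputable def ofAlgHom {A B : AlgSet P L} (s : MvPolynomial B.vars P →ₐ[P] MvPolynomial A.vars P)
    (h : ∀ p ∈ idealOf B.carrier, s p ∈ idealOf A.carrier) : A ⟶ B where
  toFun ν := ⟨ν.1.comp s, by
    rw [carrier_eq B]
    exact fun p hp => mem_idealOf.1 (h p hp) ν.1 ν.2⟩
  isInduced := ⟨s, fun _ => rfl⟩

theorem exists_eq_ofAlgHom {A B : AlgSet P L} (f : A ⟶ B) : ∃ s h, f = ofAlgHom s h := by
  obtain ⟨s, hs⟩ := f.isInduced
  refine ⟨s, fun p hp => mem_idealOf.2 fun ν hν => ?_, ?_⟩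
  · rw [← AlgHom.comp_apply, ← hs ⟨ν, hν⟩]
    exact mem_idealOf.1 hp _ (f.toFun ⟨ν, hν⟩).2
  · exact AlgSetHom.ext (funext fun ν => Subtype.ext (hs ν))

/-- Homomorphisms induce the same map when they agree at every point of `A`. Thus morphisms are
homomorphisms of coordinate algebras, in the reverse direction. -/
theorem ofAlgHom_eq_iff {A B : AlgSet P L}
    {s t : MvPolynomial B.vars P →ₐ[P] MvPolynomial A.vars P} {hs ht} :
    (ofAlgHom s hs : A ⟶ B) = ofAlgHom t ht ↔ ∀ p, s p - t p ∈ idealOf A.carrier := by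
  constructor
  · intro h p
    rw [mem_idealOf]
    intro ν hν
    have := congrArg (fun f => (f.toFun ⟨ν, hν⟩).1 p) h
    rw [map_sub, sub_eq_zero]
    exact this
  · intro h
    refine AlgSetHom.ext (funext fun ν => Subtype.ext (AlgHom.ext fun p => ?_))
    have := mem_idealOf.1 (h p) ν.1 ν.2
    rw [map_sub, sub_eq_zero] at this
    exact this

theorem ofAlgHom_eq_iff_X {A B : AlgSet P L}
    {s t : MvPolynomial B.vars P →ₐ[P] MvPolynomial A.vars P} {hs ht} :
    (ofAlgHom s hs : A ⟶ B) = ofAlgHom t ht ↔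
      ∀ i, s (MvPolynomial.X i) - t (MvPolynomial.X i) ∈ idealOf A.carrier := by
  refine ⟨fun h i => ofAlgHom_eq_iff.1 h _, fun h => ?_⟩
  refine AlgSetHom.ext (funext fun ν => Subtype.ext (MvPolynomial.algHom_ext fun i => ?_))
  have := mem_idealOf.1 (h i) ν.1 ν.2
  rw [map_sub, sub_eq_zero] at this
  exact this

theorem ofAlgHom_id (A : AlgSet P L) : 𝟙 A = ofAlgHom (AlgHom.id P _) (fun p h => by rwa [AlgHom.id_apply]) :=
  rfl

theorem ofAlgHom_comp {A B C : AlgSet P L}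
    (s : MvPolynomial B.vars P →ₐ[P] MvPolynomial A.vars P) (hs)
    (t : MvPolynomial C.vars P →ₐ[P] MvPolynomial B.vars P) (ht) :
    (ofAlgHom s hs : A ⟶ B) ≫ (ofAlgHom t ht : B ⟶ C)
      = ofAlgHom (s.comp t) (fun p hp => by rw [AlgHom.comp_apply]; exact hs _ (ht p hp)) := rfl

section Transfer

variable {L₁ : Type v} [Field L₁] [Algebra P L₁] {L₂ : Type w} [Field L₂] [Algebra P L₂]
  {σ : P ≃+* P}

/-- The algebraic set over `L₂` that corresponds to an algebraic set over `L₁`. -/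
abbrev transferObj (σ : P ≃+* P) (L₂ : Type w) [Field L₂] [Algebra P L₂] (A : AlgSet P L₁) :
    AlgSet P L₂ where
  vars := A.vars
  finite_vars := A.finite_vars
  carrier := solutions L₂ (MvPolynomial.map (σ : P →+* P) '' idealOf A.carrier)
  isAlgebraic := ⟨_, rfl⟩

/-- The ideal of an algebraic set is closed, so by `H` its σ-image is closed over `L₂`: passing to
solutions adds no further polynomials. -/
theorem map_mem_idealOf_transferObj (H : ClosuresCorrespond P σ L₁ L₂) (A : AlgSet P L₁)
    (p : MvPolynomial A.vars P) :
    MvPolynomial.map (σ : P →+* P) p ∈ idealOf (X := A.vars) (transferObj σ L₂ A).carrier ↔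
      p ∈ idealOf A.carrier := by
  have := H A.vars (idealOf A.carrier) p
  rw [closureOver_idealOf] at this
  exact this

theorem transfer_isWellDefined (H : ClosuresCorrespond P σ L₁ L₂) {A B : AlgSet P L₁}
    {s : MvPolynomial B.vars P →ₐ[P] MvPolynomial A.vars P}
    (h : ∀ p ∈ idealOf B.carrier, s p ∈ idealOf A.carrier) :
    ∀ p ∈ idealOf (X := B.vars) (transferObj σ L₂ B).carrier,
      twistAlgHom σ s p ∈ idealOf (X := A.vars) (transferObj σ L₂ A).carrier := by
  intro p hp
  rw [← map_symm_map σ p] at hp ⊢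
  rw [map_mem_idealOf_transferObj H] at hp
  exact twistAlgHom_map σ s _ ▸ (map_mem_idealOf_transferObj H A _).2 (h _ hp)

/-- The morphism over `L₂` induced by the twist of a homomorphism. -/
noncomputable def transferHom (H : ClosuresCorrespond P σ L₁ L₂) {A B : AlgSet P L₁}
    (s : MvPolynomial B.vars P →ₐ[P] MvPolynomial A.vars P)
    (hs : ∀ p ∈ idealOf B.carrier, s p ∈ idealOf A.carrier) :
    transferObj σ L₂ A ⟶ transferObj σ L₂ B :=
  ofAlgHom (twistAlgHom σ s) (transfer_isWellDefined H hs)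

/-- The morphism over `L₂` that corresponds to a morphism over `L₁`. -/
noncomputable def transferMap (H : ClosuresCorrespond P σ L₁ L₂) {A B : AlgSet P L₁} (f : A ⟶ B) :
    transferObj σ L₂ A ⟶ transferObj σ L₂ B :=
  transferHom H (exists_eq_ofAlgHom f).choose (exists_eq_ofAlgHom f).choose_spec.choose

/-- One direction makes `transferMap` independent of the chosen representative; the other gives
faithfulness. -/
theorem transfer_eq_iff (H : ClosuresCorrespond P σ L₁ L₂) {A B : AlgSet P L₁}
    {s t : MvPolynomial B.vars P →ₐ[P] MvPolynomial A.vars P} (hs ht) :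
    transferHom H s hs = transferHom H t ht ↔ (ofAlgHom s hs : A ⟶ B) = ofAlgHom t ht := by
  rw [transferHom, transferHom, ofAlgHom_eq_iff, ofAlgHom_eq_iff]
  constructor
  · intro h p
    rw [← map_mem_idealOf_transferObj H, map_sub, ← twistAlgHom_map, ← twistAlgHom_map]
    exact h _
  · intro h p
    rw [← map_symm_map σ p]
    erw [twistAlgHom_map, twistAlgHom_map]
    rw [← map_sub]
    exact (map_mem_idealOf_transferObj H A _).2 (h _)

theorem transferMap_ofAlgHom (H : ClosuresCorrespond P σ L₁ L₂) {A B : AlgSet P L₁}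
    (s : MvPolynomial B.vars P →ₐ[P] MvPolynomial A.vars P) (hs) :
    transferMap H (ofAlgHom s hs : A ⟶ B) = transferHom H s hs :=
  (transfer_eq_iff H _ _).2 (exists_eq_ofAlgHom (ofAlgHom s hs)).choose_spec.choose_spec.symm

/-- The functor between categories of algebraic sets given by an automorphism of `P` under which
the closure operators correspond. -/
noncomputable def transfer (H : ClosuresCorrespond P σ L₁ L₂) : AlgSet P L₁ ⥤ AlgSet P L₂ where
  obj := transferObj σ L₂
  map := transferMap H
  map_id A := by
    rw [ofAlgHom_id, transferMap_ofAlgHom, transferHom, ofAlgHom_id, ofAlgHom_eq_iff_X]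
    intro i
    simp [twistAlgHom]
  map_comp {A B C} f g := by
    obtain ⟨s, hs, rfl⟩ := exists_eq_ofAlgHom f
    obtain ⟨t, ht, rfl⟩ := exists_eq_ofAlgHom g
    rw [ofAlgHom_comp, transferMap_ofAlgHom, transferMap_ofAlgHom, transferMap_ofAlgHom,
      transferHom, transferHom, transferHom,     ofAlgHom_comp, ofAlgHom_eq_iff_X]
    intro i
    have h1 : twistAlgHom σ (s.comp t) (MvPolynomial.X i)
        = twistAlgHom σ s (twistAlgHom σ t (MvPolynomial.X i)) := by
      rw [← MvPolynomial.map_X (σ : P →+* P), twistAlgHom_map, twistAlgHom_map, twistAlgHom_map]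
      rfl
    have h2 := (sub_eq_zero.2 h1)
    exact h2 ▸ Submodule.zero_mem _

instance (H : ClosuresCorrespond P σ L₁ L₂) : (transfer H).Faithful where
  map_injective {A B f g} h := by
    obtain ⟨s, hs, rfl⟩ := exists_eq_ofAlgHom f
    obtain ⟨t, ht, rfl⟩ := exists_eq_ofAlgHom g
    exact (transfer_eq_iff H hs ht).1
      (((transferMap_ofAlgHom H s hs).symm.trans h).trans (transferMap_ofAlgHom H t ht))

instance (H : ClosuresCorrespond P σ L₁ L₂) : (transfer H).Full where
  map_surjective {A B} f := by
    obtain ⟨t, ht, rfl⟩ := exists_eq_ofAlgHom f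
    change MvPolynomial B.vars P →ₐ[P] MvPolynomial A.vars P at t
    obtain ⟨s, rfl⟩ : ∃ s, t = twistAlgHom σ s := by
      refine ⟨twistAlgHom σ.symm t, MvPolynomial.algHom_ext fun i => ?_⟩
      simp [twistAlgHom, map_symm_map]
    have hs : ∀ p ∈ idealOf B.carrier, s p ∈ idealOf A.carrier := by
      intro p hp
      rw [← map_mem_idealOf_transferObj H, ← twistAlgHom_map]
      exact ht _ ((map_mem_idealOf_transferObj H B p).2 hp)
    exact ⟨ofAlgHom s hs, transferMap_ofAlgHom H s hs⟩

theorem transfer_obj_bijective (H : ClosuresCorrespond P σ L₁ L₂) :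
    Function.Bijective (transfer H).obj := by
  constructor
  · intro A B h
    change transferObj σ L₂ A = transferObj σ L₂ B at h
    have key : ∀ (X : Type) (hX : Finite X) (A B : Set (Points P L₁ X)) hA hB,
        transferObj σ L₂ ⟨X, hX, A, hA⟩ = transferObj σ L₂ ⟨X, hX, B, hB⟩ → A = B := by
      intro X hX A B hA hB h
      have hi : idealOf A = idealOf B := by
        simp only [transferObj, mk.injEq, heq_eq_eq, true_and] at h
        ext p
        rw [← map_mem_idealOf_transferObj H ⟨X, hX, A, hA⟩ p,
          ← map_mem_idealOf_transferObj H ⟨X, hX, B, hB⟩ p]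
        exact iff_of_eq (congrArg (fun S => MvPolynomial.map (σ : P →+* P) p ∈ idealOf S) h)
      have h1 := carrier_eq ⟨X, hX, A, hA⟩
      have h2 := carrier_eq ⟨X, hX, B, hB⟩
      simp only at h1 h2
      rw [h1, h2, hi]
    obtain ⟨X, hX, A, hA⟩ := A
    obtain ⟨Y, hY, B, hB⟩ := B
    obtain rfl : X = Y := congrArg AlgSet.vars h
    obtain rfl := key X hX A B hA hB h
    rfl
  · intro B
    -- The preimage of `B` is cut out by its ideal with coefficients pulled back along σ; that
    -- pulled-back ideal is already closed over `L₁`.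
    refine ⟨⟨B.vars, B.finite_vars, solutions L₁
      (MvPolynomial.map (σ : P →+* P) ⁻¹' (idealOf B.carrier)), _, rfl⟩, ?_⟩
    have hi : MvPolynomial.map (σ : P →+* P) '' (idealOf (solutions L₁
        (MvPolynomial.map (σ : P →+* P) ⁻¹' (idealOf B.carrier : Set (MvPolynomial B.vars P)))) :
        Set (MvPolynomial B.vars P))
        = idealOf B.carrier := by
      have hsurj : Function.Surjective
          (MvPolynomial.map (σ := B.vars) (σ : P →+* P)) := fun q => ⟨_, map_symm_map σ q⟩
      have hm : ∀ p, p ∈ idealOf (solutions L₁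
          (MvPolynomial.map (σ : P →+* P) ⁻¹' (idealOf B.carrier : Set (MvPolynomial B.vars P)))) ↔
          MvPolynomial.map (σ : P →+* P) p ∈ idealOf B.carrier := by
        intro p
        have := H B.vars (MvPolynomial.map (σ : P →+* P) ⁻¹' idealOf B.carrier) p
        rw [Set.image_preimage_eq _ hsurj, closureOver_idealOf] at this
        exact this.symm
      ext q
      constructor
      · rintro ⟨p, hp, rfl⟩
        exact (hm p).1 hp
      · intro hq
        obtain ⟨p, rfl⟩ := hsurj q
        exact ⟨p, (hm p).2 hq, rfl⟩
    have : solutions L₂ (MvPolynomial.map (σ : P →+* P) '' (idealOf (solutions L₁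
        (MvPolynomial.map (σ : P →+* P) ⁻¹' (idealOf B.carrier : Set (MvPolynomial B.vars P)))) :
        Set (MvPolynomial B.vars P)))
        = B.carrier := by rw [hi, ← carrier_eq]
    obtain ⟨Y, hY, B, hB⟩ := B
    simp only [transfer, transferObj, mk.injEq, heq_eq_eq, true_and]
    exact this

end Transfer

end AlgSet

/-! ### Strict monomorphisms and constant morphisms in any category -/

section Category

variable {C : Type*} [Category C] {D : Type*} [Category D]

/-- A monomorphism `i` through which every morphism factors that is coequalized by all the pairs
that `i` coequalizes. -/
def IsStrictMono {B A : C} (i : B ⟶ A) : Prop :=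
  Mono i ∧ ∀ ⦃W : C⦄ (k : W ⟶ A), (∀ ⦃E : C⦄ (f g : A ⟶ E), i ≫ f = i ≫ g → k ≫ f = k ≫ g) →
    ∃ l, l ≫ i = k

theorem IsStrictMono.of_map (F : C ⥤ D) [F.Full] [F.Faithful] [F.EssSurj] {B A : C} {i : B ⟶ A}
    (h : IsStrictMono (F.map i)) : IsStrictMono i := by
  obtain ⟨hm, h⟩ := h
  refine ⟨F.mono_of_mono_map hm, fun W k hk => ?_⟩
  obtain ⟨l, hl⟩ := h (F.map k) fun E f g hfg => by
    let e := F.objObjPreimageIso E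
    obtain ⟨f', hf⟩ := F.map_surjective (f ≫ e.inv)
    obtain ⟨g', hg⟩ := F.map_surjective (g ≫ e.inv)
    have h1 : i ≫ f' = i ≫ g' := F.map_injective (by simp [hf, hg, reassoc_of% hfg])
    have h2 := congrArg F.map (hk f' g' h1)
    rw [F.map_comp, F.map_comp, hf, hg, ← Category.assoc, ← Category.assoc, cancel_mono] at h2
    exact h2
  obtain ⟨l, rfl⟩ := F.map_surjective l
  exact ⟨l, F.map_injective (by rw [F.map_comp, hl])⟩

theorem IsStrictMono.comp_iso {B A A' : C} {i : B ⟶ A} (h : IsStrictMono i) (d : A ≅ A') :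
    IsStrictMono (i ≫ d.hom) := by
  obtain ⟨hm, h⟩ := h
  refine ⟨inferInstance, fun W k hk => ?_⟩
  obtain ⟨l, hl⟩ := h (k ≫ d.inv) fun E f g hfg => by
    have := hk (d.inv ≫ f) (d.inv ≫ g) (by simpa using hfg)
    simpa using this
  exact ⟨l, by rw [← Category.assoc, hl]; simp⟩

/-- A morphism that does not distinguish its generalized points. -/
def IsConst {B A : C} (f : B ⟶ A) : Prop := ∀ ⦃W : C⦄ (a b : W ⟶ B), a ≫ f = b ≫ f

theorem IsConst.comp_left {B A E : C} {f : B ⟶ A} (h : IsConst f) (g : E ⟶ B) :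
    IsConst (g ≫ f) := fun W a b => by
  rw [← Category.assoc, ← Category.assoc]
  exact h _ _

theorem IsConst.comp_right {B A E : C} {f : B ⟶ A} (h : IsConst f) (g : A ⟶ E) :
    IsConst (f ≫ g) := fun W a b => by
  rw [← Category.assoc, ← Category.assoc, h a b]

theorem isConst_map_iff (F : C ⥤ D) [F.Full] [F.Faithful] [F.EssSurj] {B A : C} (f : B ⟶ A) :
    IsConst (F.map f) ↔ IsConst f := by
  constructor
  · intro h W a b
    exact F.map_injective (by rw [F.map_comp, F.map_comp]; exact h _ _)
  · intro h W a b
    let e := F.objObjPreimageIso W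
    obtain ⟨a', ha⟩ := F.map_surjective (e.hom ≫ a)
    obtain ⟨b', hb⟩ := F.map_surjective (e.hom ≫ b)
    have := congrArg F.map (h a' b')
    rw [F.map_comp, F.map_comp, ha, hb, Category.assoc, Category.assoc, cancel_epi] at this
    exact this

end Category

/-! ### Affine spaces as algebraic sets -/

namespace AlgSet

open PolyAlg

section Affine

variable {P : Type u} [Field P] {L : Type v} [Field L] [Algebra P L]

/-- The points with coordinates in the infinite field `P` already separate polynomials. -/
theorem idealOf_univ [Infinite P] {X : Type} : idealOf (Set.univ : Set (Points P L X)) = ⊥ := by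
  rw [eq_bot_iff]
  intro p hp
  rw [mem_idealOf] at hp
  rw [Ideal.mem_bot]
  apply MvPolynomial.funext
  intro a
  have := hp ((Algebra.ofId P L).comp (MvPolynomial.aeval a)) trivial
  rw [AlgHom.comp_apply, Algebra.ofId_apply, map_eq_zero, MvPolynomial.aeval_eq_eval] at this
  rw [map_zero]
  exact this

/-- The affine space over `L` as an algebraic set. -/
abbrev aff (L : Type v) [Field L] [Algebra P L] (X : PolyAlg P) : AlgSet P L where
  vars := X.vars
  finite_vars := X.finite_vars
  carrier := Set.univ
  isAlgebraic := ⟨∅, by ext; simp [mem_solutions]⟩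

/-- The polynomial algebra in the variables of an algebraic set. -/
abbrev poly (A : AlgSet P L) : PolyAlg P := ⟨A.vars, A.finite_vars⟩

/-- The morphism to an affine space given by any homomorphism of polynomial algebras. -/
noncomputable def toAff {A : AlgSet P L} {X : PolyAlg P}
    (s : MvPolynomial X.vars P →ₐ[P] MvPolynomial A.vars P) : A ⟶ aff L X :=
  ofAlgHom s fun _ hp => mem_idealOf.2 fun ν _ => mem_idealOf.1 hp (ν.comp s) trivial

/-- The inclusion of an algebraic set in its affine space. -/
noncomputable def incl (A : AlgSet P L) : A ⟶ aff L A.poly := toAff (AlgHom.id P _)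

/-- The function on an algebraic set given by a polynomial. -/
noncomputable def fn {A : AlgSet P L} (p : MvPolynomial A.vars P) : A ⟶ aff L (line P) :=
  toAff (MvPolynomial.aeval fun _ => p)

theorem fn_eq_iff {A : AlgSet P L} {p q : MvPolynomial A.vars P} :
    fn p = fn q ↔ p - q ∈ idealOf A.carrier := by
  rw [fn, fn, toAff, toAff, ofAlgHom_eq_iff_X]
  simp

theorem ofAlgHom_comp_fn {A B : AlgSet P L}
    (s : MvPolynomial B.vars P →ₐ[P] MvPolynomial A.vars P) (hs) (p : MvPolynomial B.vars P) :
    (ofAlgHom s hs : A ⟶ B) ≫ fn p = fn (s p) := by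
  rw [fn, fn, toAff, toAff, ofAlgHom_comp, ofAlgHom_eq_iff_X]
  intro i
  simp

/-- Each equation `p` of `A` gives a pair `fn p`, `fn 0` that the inclusion coequalizes; a morphism
coequalizing all these pairs satisfies the equations of `A`. -/
theorem isStrictMono_incl (A : AlgSet P L) : IsStrictMono (incl A) := by
  refine ⟨⟨fun {W} a b hab => ?_⟩, fun W k hk => ?_⟩
  · obtain ⟨s, hs, rfl⟩ := exists_eq_ofAlgHom a
    obtain ⟨t, ht, rfl⟩ := exists_eq_ofAlgHom b
    rw [incl, toAff, ofAlgHom_comp, ofAlgHom_comp, ofAlgHom_eq_iff] at hab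
    rw [ofAlgHom_eq_iff]
    exact hab
  · obtain ⟨s, hs, rfl⟩ := exists_eq_ofAlgHom k
    have h : ∀ p ∈ idealOf A.carrier, s p ∈ idealOf W.carrier := by
      intro p hp
      have h1 : incl A ≫ fn p = incl A ≫ fn 0 := by
        rw [incl, toAff, ofAlgHom_comp_fn, ofAlgHom_comp_fn, fn_eq_iff]
        simpa using hp
      have h2 := hk _ _ h1
      rw [ofAlgHom_comp_fn, ofAlgHom_comp_fn, fn_eq_iff, map_zero, sub_zero] at h2
      exact h2
    exact ⟨ofAlgHom s h, rfl⟩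

/-- Affine spaces are injective for strict monomorphisms. -/
theorem exists_retraction_of_isStrictMono [Infinite P] {X : PolyAlg P} {A : AlgSet P L}
    {j : aff L X ⟶ A} (h : IsStrictMono j) : ∃ ρ : A ⟶ aff L X, j ≫ ρ = 𝟙 _ := by
  obtain ⟨hm, h⟩ := h
  obtain ⟨s, hs, rfl⟩ := exists_eq_ofAlgHom j
  -- `Z` is the closure of the image of `j`. Pairs coequalized by `j` agree on `Z`, so strictness
  -- lifts the inclusion of `Z` in `A` to a morphism `Z ⟶ aff L X`.
  let Z : AlgSet P L := ⟨A.vars, A.finite_vars,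
    solutions L (RingHom.ker s : Set (MvPolynomial A.vars P)), _, rfl⟩
  have hker : ∀ p, s p = 0 → p ∈ idealOf Z.carrier := fun p hp => subset_closureOver _ hp
  have hbot : ∀ p, s p ∈ idealOf (aff L X).carrier → s p = 0 := by
    intro p hp
    rw [idealOf_univ] at hp
    exact hp
  let k : Z ⟶ A := ofAlgHom (AlgHom.id P _) fun _ hp => hker _ (hbot _ (hs _ hp))
  obtain ⟨l, hl⟩ := h k fun E f g hfg => by
    obtain ⟨a, ha, rfl⟩ := exists_eq_ofAlgHom f
    obtain ⟨b, hb, rfl⟩ := exists_eq_ofAlgHom g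
    rw [ofAlgHom_comp, ofAlgHom_comp, ofAlgHom_eq_iff] at hfg
    change ofAlgHom _ _ ≫ _ = ofAlgHom _ _ ≫ _
    rw [ofAlgHom_comp, ofAlgHom_comp, ofAlgHom_eq_iff]
    intro p
    have h1 : s (a p - b p) ∈ idealOf (aff L X).carrier := by
      rw [map_sub]
      exact hfg p
    exact hker _ (hbot _ h1)
  obtain ⟨t, ht, rfl⟩ := exists_eq_ofAlgHom l
  -- A morphism to an affine space need not respect any equations, so the homomorphism inducing the
  -- lift on `Z` also defines a morphism on all of `A`.
  refine ⟨toAff (A := A) t, ?_⟩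
  let j₀ : aff L X ⟶ Z := ofAlgHom (A := aff L X) (B := Z) s fun p hp =>
    mem_idealOf.2 fun ν _ => mem_idealOf.1 hp (ν.comp s) fun q hq => by
      rw [SetLike.mem_coe, RingHom.mem_ker] at hq ⊢
      exact (congrArg ν hq).trans (map_zero _)
  rw [← cancel_mono (ofAlgHom s hs)]
  have h1 : ofAlgHom s hs ≫ toAff (A := A) t = j₀ ≫ ofAlgHom t ht := rfl
  rw [h1, Category.assoc, hl]
  rfl

theorem isConst_ofAlgHom_iff [Infinite P] {X : PolyAlg P} {A : AlgSet P L}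
    (s : MvPolynomial A.vars P →ₐ[P] MvPolynomial X.vars P) (hs) :
    IsConst (ofAlgHom s hs : aff L X ⟶ A) ↔
      ∀ i, ∃ c, s (MvPolynomial.X i) = MvPolynomial.C c := by
  constructor
  · intro h i
    -- The collapse of the affine space to its origin; a constant morphism does not distinguish it
    -- from the identity.
    let z : MvPolynomial X.vars P →ₐ[P] MvPolynomial X.vars P :=
      (Algebra.ofId P _).comp (MvPolynomial.aeval fun _ => (0 : P))
    have h1 := h (𝟙 _) (toAff (A := aff L X) (X := X) z)
    rw [ofAlgHom_id, toAff, ofAlgHom_comp, ofAlgHom_comp, ofAlgHom_eq_iff_X] at h1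
    have h2 := h1 i
    rw [idealOf_univ, Ideal.mem_bot, sub_eq_zero] at h2
    exact ⟨_, h2⟩
  · intro h W a b
    obtain ⟨t, ht, rfl⟩ := exists_eq_ofAlgHom a
    obtain ⟨r, hr, rfl⟩ := exists_eq_ofAlgHom b
    rw [ofAlgHom_comp, ofAlgHom_comp, ofAlgHom_eq_iff_X]
    intro i
    obtain ⟨c, hc⟩ := h i
    rw [AlgHom.comp_apply, AlgHom.comp_apply, hc, MvPolynomial.algHom_C, MvPolynomial.algHom_C,
      sub_self]
    exact Submodule.zero_mem _

/-- A nonconstant morphism from an affine space is nonconstant on some line. -/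
theorem exists_line_not_isConst [Infinite P] {X : PolyAlg P} {A : AlgSet P L} {f : aff L X ⟶ A}
    (hf : ¬ IsConst f) : ∃ m : aff L (line P) ⟶ aff L X, ¬ IsConst (m ≫ f) := by
  obtain ⟨s, hs, rfl⟩ := exists_eq_ofAlgHom f
  rw [isConst_ofAlgHom_iff] at hf
  push Not at hf
  obtain ⟨i, hi⟩ := hf
  obtain ⟨b, hb⟩ : ∃ b : X.vars → P, MvPolynomial.eval b (s (MvPolynomial.X i))
      ≠ MvPolynomial.eval 0 (s (MvPolynomial.X i)) := by
    by_contra! hb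
    refine hi (MvPolynomial.eval 0 (s (MvPolynomial.X i))) (MvPolynomial.funext fun b => (hb b).trans ?_)
    rw [MvPolynomial.eval_C]
  -- The line joining the origin to `b`, whose parameters 0 and 1 give the two points with different
  -- values.
  let m : MvPolynomial X.vars P →ₐ[P] MvPolynomial (line P).vars P :=
    MvPolynomial.aeval fun j => MvPolynomial.C (b j) * MvPolynomial.X default
  refine ⟨toAff (A := aff L (line P)) m, fun h => hb ?_⟩
  rw [toAff, ofAlgHom_comp, isConst_ofAlgHom_iff] at h
  obtain ⟨c, hc⟩ := h i
  have hm : ∀ (t : P) (p : MvPolynomial X.vars P),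
      MvPolynomial.eval (fun _ => t) (m p) = MvPolynomial.eval (fun j => b j * t) p := by
    intro t p
    induction p using MvPolynomial.induction_on with
    | C c => rw [MvPolynomial.algHom_C, MvPolynomial.algebraMap_eq, MvPolynomial.eval_C,
        MvPolynomial.eval_C]
    | add p q hp hq => rw [map_add, map_add, map_add, hp, hq]
    | mul_X p j hp =>
      rw [map_mul, map_mul, map_mul, hp]
      simp [m]
  rw [AlgHom.comp_apply] at hc
  have h0 := hm 0 (s (MvPolynomial.X i))
  have h1 := hm 1 (s (MvPolynomial.X i))
  rw [hc, MvPolynomial.eval_C] at h0 h1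
  simp only [mul_zero, mul_one] at h0 h1
  exact h1.symm.trans h0

/-- Degrees multiply under composition of polynomials in one variable. -/
theorem isConst_or_of_comp_line [Infinite P] {A : AlgSet P L} {a : aff L (line P) ⟶ aff L (line P)}
    {b : aff L (line P) ⟶ A} (h : IsConst (a ≫ b)) : IsConst a ∨ IsConst b := by
  obtain ⟨s, hs, rfl⟩ := exists_eq_ofAlgHom a
  obtain ⟨t, ht, rfl⟩ := exists_eq_ofAlgHom b
  rw [ofAlgHom_comp, isConst_ofAlgHom_iff] at h
  rw [isConst_ofAlgHom_iff, isConst_ofAlgHom_iff]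
  have hU : ∀ q : MvPolynomial (line P).vars P,
      (MvPolynomial.uniqueAlgEquiv P (line P).vars q).natDegree = 0 →
      ∃ c, q = MvPolynomial.C c := by
    intro q hq
    rw [Polynomial.natDegree_eq_zero] at hq
    obtain ⟨c, hc⟩ := hq
    refine ⟨c, (MvPolynomial.uniqueAlgEquiv P (line P).vars).injective ?_⟩
    rw [← hc]
    simp
  by_cases hd : (toPoly (s : line P ⟶ line P)).natDegree = 0
  · left
    intro i
    obtain rfl : i = default := Unique.eq_default i
    exact hU _ hd
  · right
    intro i
    obtain ⟨c, hc⟩ := h i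
    have h1 := uniqueAlgEquiv_toAlgHom (s : line P ⟶ line P) (t (MvPolynomial.X i))
    have h2 : toAlgHom (s : line P ⟶ line P) (t (MvPolynomial.X i)) = MvPolynomial.C c := hc
    rw [h2] at h1
    have h3 := congrArg Polynomial.natDegree h1
    rw [Polynomial.natDegree_comp] at h3
    have h4 : (MvPolynomial.uniqueAlgEquiv P (line P).vars (MvPolynomial.C c)).natDegree = 0 := by
      simp
    rw [h4] at h3
    exact hU _ ((mul_eq_zero.1 h3.symm).resolve_right hd)

/-- The functor of affine spaces. -/
noncomputable def affine (P : Type u) [Field P] (L : Type v) [Field L] [Algebra P L] :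
    (PolyAlg P)ᵒᵖ ⥤ AlgSet P L where
  obj X := aff L X.unop
  map f := toAff (toAlgHom f.unop)
  map_id _ := rfl
  map_comp _ _ := rfl

instance [Infinite P] : (affine P L).Faithful where
  map_injective {X Y f g} h := by
    change toAff (A := aff L X.unop) (X := Y.unop) (toAlgHom f.unop) = toAff (toAlgHom g.unop) at h
    rw [toAff, toAff, ofAlgHom_eq_iff_X] at h
    refine Quiver.Hom.unop_inj (PolyAlg.hom_ext fun i => ?_)
    have h1 := h i
    rw [idealOf_univ, Ideal.mem_bot, sub_eq_zero] at h1
    exact h1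

instance : (affine P L).Full where
  map_surjective {X Y} f := by
    obtain ⟨s, hs, rfl⟩ := exists_eq_ofAlgHom f
    exact ⟨Quiver.Hom.op (X := Y.unop) (Y := X.unop) s, rfl⟩

theorem isPower_fn_X (X : PolyAlg P) :
    IsPower fun i : X.vars => (fn (MvPolynomial.X i) : aff L X ⟶ aff L (line P)) := by
  intro W g
  choose s hs hg using fun i => exists_eq_ofAlgHom (g i)
  refine ⟨toAff (A := W) (X := X) (MvPolynomial.aeval fun i => s i (MvPolynomial.X default)),
    fun i => ?_, fun h hh => ?_⟩
  · refine Eq.trans (ofAlgHom_comp_fn _ _ _) ?_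
    rw [hg, fn, toAff, ofAlgHom_eq_iff_X]
    intro j
    obtain rfl : j = default := Unique.eq_default (α := (line P).vars) j
    simp
  · obtain ⟨t, ht, rfl⟩ := exists_eq_ofAlgHom h
    rw [toAff, ofAlgHom_eq_iff_X]
    intro i
    have h1 := (ofAlgHom_comp_fn t ht (MvPolynomial.X i)).symm.trans (hh i)
    rw [hg, fn, toAff, ofAlgHom_eq_iff_X] at h1
    simpa using h1 (default : (line P).vars)

theorem isPower_affine (X : PolyAlg P) : IsPower fun i => (affine P L).map (coordOp X i) :=
  isPower_fn_X X

end Affine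

/-! ### Vanishing along a morphism as a categorical condition -/

section Vanishes

variable {P : Type u} [Field P] {L : Type v} [Field L] [Algebra P L]

/-- The polynomials that vanish on the image of a morphism to an affine space. -/
def Vanishes {W : AlgSet P L} {X : PolyAlg P} (k : W ⟶ aff L X) (p : MvPolynomial X.vars P) :
    Prop :=
  k ≫ fn p = k ≫ fn 0

theorem vanishes_ofAlgHom_iff {W : AlgSet P L} {X : PolyAlg P}
    (s : MvPolynomial X.vars P →ₐ[P] MvPolynomial W.vars P) (hs) (p : MvPolynomial X.vars P) :
    Vanishes (ofAlgHom s hs : W ⟶ aff L X) p ↔ s p ∈ idealOf W.carrier := by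
  rw [Vanishes, ofAlgHom_comp_fn, ofAlgHom_comp_fn, fn_eq_iff, map_zero, sub_zero]

theorem vanishes_incl_iff (A : AlgSet P L) (p : MvPolynomial A.vars P) :
    Vanishes (incl A) p ↔ p ∈ idealOf A.carrier := by
  rw [incl, toAff, vanishes_ofAlgHom_iff, AlgHom.id_apply]

theorem Vanishes.of_mem_closureOver {W : AlgSet P L} {X : PolyAlg P} {k : W ⟶ aff L X}
    {U : Set (MvPolynomial X.vars P)} (h : ∀ p ∈ U, Vanishes k p) {p : MvPolynomial X.vars P}
    (hp : p ∈ closureOver L U) : Vanishes k p := by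
  obtain ⟨s, hs, rfl⟩ := exists_eq_ofAlgHom k
  rw [vanishes_ofAlgHom_iff, mem_idealOf]
  intro ν hν
  refine mem_closureOver.1 hp (ν.comp s) fun q hq => ?_
  exact mem_idealOf.1 ((vanishes_ofAlgHom_iff _ _ _).1 (h q hq)) ν hν

theorem vanishes_comp_iso_iff {W W' : AlgSet P L} {X : PolyAlg P} (e : W' ≅ W) (k : W ⟶ aff L X)
    (p : MvPolynomial X.vars P) : Vanishes (e.hom ≫ k) p ↔ Vanishes k p := by
  rw [Vanishes, Vanishes, Category.assoc, Category.assoc, cancel_epi]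

end Vanishes

/-! ### Recognizing the line among algebraic sets -/

section Line

variable {P : Type u} [Field P] [Infinite P] {L : Type v} [Field L] [Algebra P L]

/-- If `g ≫ h` is constant, so is the square of `h ≫ g`, hence `h ≫ g` itself. If `h` is not
constant, some line maps to `B` so that the composite with `h` is a nonconstant endomorphism of the
line; followed by `g` it is constant, so `g` is constant by the case of the line. -/
theorem isConst_or_of_comp_retract {B : AlgSet P L}
    (hB : ∀ f : B ⟶ B, IsConst (f ≫ f) → IsConst f) (r : aff L B.poly ⟶ B)
    (hr : incl B ≫ r = 𝟙 B) {g : aff L (line P) ⟶ B} {h : B ⟶ aff L (line P)}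
    (hgh : IsConst (g ≫ h)) : IsConst g ∨ IsConst h := by
  refine or_iff_not_imp_right.2 fun hh => ?_
  have h1 : IsConst (h ≫ g) := hB _ (by
    have := (hgh.comp_left h).comp_right g
    simpa using this)
  have h2 : ¬ IsConst (r ≫ h) := by
    intro h3
    have := h3.comp_left (incl B)
    rw [← Category.assoc, hr, Category.id_comp] at this
    exact hh this
  obtain ⟨m, hm⟩ := exists_line_not_isConst h2
  refine (isConst_or_of_comp_line (a := m ≫ r ≫ h) (b := g) ?_).resolve_left hm
  have := h1.comp_left (m ≫ r)
  simpa using this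

/-- A nonconstant retract of an affine space whose nonconstant endomorphisms have nonconstant
squares is isomorphic to the line. -/
theorem nonempty_iso_aff_line {B : AlgSet P L}
    (hB : ∀ f : B ⟶ B, IsConst (f ≫ f) → IsConst f) (hB' : ¬ IsConst (𝟙 B))
    (r : aff L B.poly ⟶ B) (hr : incl B ≫ r = 𝟙 B) : Nonempty (B ≅ aff L (line P)) := by
  have hrc : ¬ IsConst r := fun h => hB' (hr ▸ h.comp_left (incl B))
  obtain ⟨m, hm⟩ := exists_line_not_isConst hrc
  set g := m ≫ r with hg
  clear_value g
  have hor := fun {h : B ⟶ aff L (line P)} => isConst_or_of_comp_retract hB r hr (g := g) (h := h)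
  obtain ⟨ρ, hρ, rfl⟩ := exists_eq_ofAlgHom r
  obtain ⟨s, hs, rfl⟩ := exists_eq_ofAlgHom g
  have hs0 : ∀ p ∈ idealOf B.carrier, s p = 0 := by
    intro p hp
    have := hs p hp
    rw [idealOf_univ] at this
    exact this
  have hρ0 : ∀ p ∈ idealOf B.carrier, ρ p = 0 := by
    intro p hp
    have := hρ p hp
    rw [idealOf_univ] at this
    exact this
  have hρI : ∀ p, ρ p - p ∈ idealOf B.carrier := by
    rw [incl, toAff, ofAlgHom_comp, ofAlgHom_id, ofAlgHom_eq_iff] at hr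
    exact hr
  -- `g` is not constant, so `fn p` must be: `p` is congruent to a scalar on `B`, and applying `s`
  -- shows that this scalar is 0. Hence `s` embeds the coordinate algebra of `B` in `P[t]`.
  have hinj : ∀ p, s p = 0 → p ∈ idealOf B.carrier := by
    intro p hp
    have h1 : IsConst (ofAlgHom s hs ≫ fn p) := by
      rw [ofAlgHom_comp_fn, hp, fn, toAff, isConst_ofAlgHom_iff]
      intro i
      exact ⟨0, by simp⟩
    have h2 := (hor h1).resolve_left hm
    let z : MvPolynomial B.vars P →ₐ[P] MvPolynomial B.vars P :=
      (Algebra.ofId P _).comp (MvPolynomial.aeval fun _ => (0 : P))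
    have h3 := h2 (𝟙 B) (toAff (A := B) (X := B.poly) z ≫ ofAlgHom ρ hρ)
    rw [ofAlgHom_id, toAff, ofAlgHom_comp, ofAlgHom_comp_fn, ofAlgHom_comp_fn, fn_eq_iff] at h3
    obtain ⟨c, hc⟩ : ∃ c, (z.comp ρ) p = MvPolynomial.C c := ⟨_, rfl⟩
    rw [hc, AlgHom.id_apply] at h3
    have h4 := hs0 _ h3
    rw [map_sub, hp, zero_sub, neg_eq_zero, MvPolynomial.algHom_C, MvPolynomial.algebraMap_eq,
      MvPolynomial.C_eq_zero] at h4
    rwa [h4, map_zero, sub_zero] at h3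
  let U := MvPolynomial.uniqueAlgEquiv P (line P).vars
  let R := MvPolynomial B.vars P ⧸ idealOf B.carrier
  let π : MvPolynomial B.vars P →ₐ[P] R := Ideal.Quotient.mkₐ P _
  have hπ0 : ∀ p, π p = 0 ↔ p ∈ idealOf B.carrier := fun p => Ideal.Quotient.eq_zero_iff_mem
  have hπs : Function.Surjective π := Ideal.Quotient.mkₐ_surjective P _
  let γ : R →ₐ[P] Polynomial P := U.toAlgHom.comp (Ideal.Quotient.liftₐ _ s hs0)
  have hγ : ∀ p, γ (π p) = U (s p) := fun p => rfl
  let ι : R →ₐ[P] MvPolynomial B.vars P := Ideal.Quotient.liftₐ _ ρ hρ0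
  have hι : ∀ p, ι (π p) = ρ p := fun p => rfl
  obtain ⟨u, hu⟩ := exists_aeval_bijective_of_retract ι.toRingHom π.toRingHom (by
    intro x
    obtain ⟨p, rfl⟩ := hπs x
    change π (ι (π p)) = π p
    rw [hι, ← sub_eq_zero, ← map_sub, hπ0]
    exact hρI p) γ (by
    rw [injective_iff_map_eq_zero]
    intro x hx
    obtain ⟨p, rfl⟩ := hπs x
    rw [hγ, EmbeddingLike.map_eq_zero_iff] at hx
    exact (hπ0 p).2 (hinj p hx)) (by
    by_contra! hdeg
    apply hm
    rw [isConst_ofAlgHom_iff]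
    intro i
    have h1 := hdeg (π (MvPolynomial.X i))
    rw [hγ, Polynomial.natDegree_eq_zero] at h1
    obtain ⟨c, hc⟩ := h1
    refine ⟨c, U.injective ?_⟩
    rw [← hc]
    simp [U])
  obtain ⟨u, rfl⟩ := hπs u
  let e := AlgEquiv.ofBijective (Polynomial.aeval (π u) : Polynomial P →ₐ[P] R) hu
  let t : MvPolynomial B.vars P →ₐ[P] MvPolynomial (line P).vars P :=
    MvPolynomial.aeval fun i => U.symm (e.symm (π (MvPolynomial.X i)))
  have ht : ∀ p, U (t p) = e.symm (π p) := by
    intro p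
    have : U.toAlgHom.comp t = e.symm.toAlgHom.comp π :=
      MvPolynomial.algHom_ext fun i => by simp [t]
    exact congrArg (fun φ => φ p) this
  let q : MvPolynomial (line P).vars P →ₐ[P] MvPolynomial B.vars P := MvPolynomial.aeval fun _ => u
  have hq : ∀ p, π (q p) = e (U p) := by
    intro p
    have : π.comp q = e.toAlgHom.comp U.toAlgHom :=
      MvPolynomial.algHom_ext fun i => by simp [q, U, e]
    exact congrArg (fun φ => φ p) this
  have hti : ∀ p ∈ idealOf B.carrier, t p ∈ idealOf (aff L (line P)).carrier := by
    intro p hp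
    have h1 : t p = 0 := U.injective (by rw [ht, (hπ0 p).2 hp, map_zero, map_zero])
    exact h1 ▸ Submodule.zero_mem _
  refine ⟨⟨toAff (A := B) (X := line P) q, ofAlgHom (A := aff L (line P)) t hti, ?_, ?_⟩⟩
  · rw [toAff, ofAlgHom_comp, ofAlgHom_id, ofAlgHom_eq_iff]
    intro p
    rw [← hπ0, map_sub, sub_eq_zero, AlgHom.comp_apply, hq, ht, AlgEquiv.apply_symm_apply,
      AlgHom.id_apply]
  · rw [toAff, ofAlgHom_comp, ofAlgHom_id, ofAlgHom_eq_iff]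
    intro p
    have h1 : t (q p) = p := U.injective (by rw [ht, hq, AlgEquiv.symm_apply_apply])
    rw [AlgHom.comp_apply, h1, AlgHom.id_apply, sub_self]
    exact Submodule.zero_mem _

end Line

/-! ### Equivalences act by a twist and match closures -/

section Equivalence

variable {P : Type u} [Field P] [Infinite P] {L₁ : Type v} [Field L₁] [Algebra P L₁] {L₂ : Type w}
  [Field L₂] [Algebra P L₂]

/-- Equivalences of categories of algebraic sets preserve the line. -/
theorem nonempty_map_line_iso (F : AlgSet P L₁ ⥤ AlgSet P L₂) [F.Full] [F.Faithful] [F.EssSurj] :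
    Nonempty (F.obj (aff L₁ (line P)) ≅ aff L₂ (line P)) := by
  -- The inclusion of the image of the line in its affine space is strict; pulled back through `F`
  -- it starts at a line, hence splits, and `F` carries the splitting back.
  let d := F.objObjPreimageIso (aff L₂ (F.obj (aff L₁ (line P))).poly)
  obtain ⟨j, hj⟩ := F.map_surjective (incl (F.obj (aff L₁ (line P))) ≫ d.inv)
  have hj' : IsStrictMono j := IsStrictMono.of_map F (by
    rw [hj]
    exact (isStrictMono_incl _).comp_iso d.symm)
  obtain ⟨ρ, hρ⟩ := exists_retraction_of_isStrictMono hj'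
  refine nonempty_iso_aff_line (fun f hf => ?_) (fun h => ?_) (d.inv ≫ F.map ρ) ?_
  · obtain ⟨f, rfl⟩ := F.map_surjective f
    rw [← F.map_comp, isConst_map_iff] at hf
    rw [isConst_map_iff]
    exact (isConst_or_of_comp_line hf).elim id id
  · rw [← F.map_id, isConst_map_iff, ofAlgHom_id, isConst_ofAlgHom_iff] at h
    obtain ⟨c, hc⟩ := h (default : (line P).vars)
    rw [AlgHom.id_apply] at hc
    have := congrArg (fun p => (MvPolynomial.eval (fun _ => c + 1)) p) hc
    simp at this
  · rw [← Category.assoc, ← hj, ← F.map_comp, hρ, F.map_id]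

/-- Isomorphic categories of algebraic sets have corresponding closure operators. -/
theorem exists_closuresCorrespond (F : AlgSet P L₁ ⥤ AlgSet P L₂) [F.Full] [F.Faithful]
    [F.EssSurj] : ∃ σ : P ≃+* P, ClosuresCorrespond P σ L₁ L₂ := by
  obtain ⟨σ, e, he⟩ := exists_twist_iso (affine P L₁ ⋙ F) (affine P L₂)
    (fun X => (isPower_affine X).map F) isPower_affine (nonempty_map_line_iso F)
  let e' : ∀ X : PolyAlg P, F.obj (aff L₁ X) ≅ aff L₂ X := e
  have hel : ∀ (X : PolyAlg P) (p : MvPolynomial X.vars P),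
      twist σ (elem X p) = elem X (MvPolynomial.map (σ : P →+* P) p) := by
    intro X p
    refine line_hom_ext ?_
    have h := toAlgHom_twist_map σ (elem X p) (MvPolynomial.X default)
    rw [MvPolynomial.map_X] at h
    rw [h, toAlgHom_elem_X, toAlgHom_elem_X]
  have hfn : ∀ (X : PolyAlg P) (p : MvPolynomial X.vars P),
      F.map (fn (A := aff L₁ X) p) ≫ (e' (line P)).hom
        = (e' X).hom ≫ fn (MvPolynomial.map (σ : P →+* P) p) := by
    intro X p
    have h := he (line P) X (elem X p)
    rw [hel] at h
    exact h
  have hv : ∀ (W : AlgSet P L₁) (X : PolyAlg P) (k : W ⟶ aff L₁ X) (p : MvPolynomial X.vars P),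
      Vanishes (F.map k ≫ (e' X).hom) (MvPolynomial.map (σ : P →+* P) p) ↔ Vanishes k p := by
    intro W X k p
    have h0 := hfn X 0
    rw [map_zero] at h0
    rw [Vanishes, Vanishes, Category.assoc, Category.assoc, ← hfn, ← h0, ← Category.assoc,
      ← Category.assoc, cancel_mono, ← F.map_comp, ← F.map_comp]
    exact F.map_injective.eq_iff
  have main : ∀ (X : PolyAlg P) (U : Set (MvPolynomial X.vars P)) (p : MvPolynomial X.vars P),
      MvPolynomial.map (σ : P →+* P) p ∈ closureOver L₂ (MvPolynomial.map (σ : P →+* P) '' U) ↔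
        p ∈ closureOver L₁ U := by
    intro X U p
    constructor
    · intro hp
      let A : AlgSet P L₁ := ⟨X.vars, X.finite_vars, solutions L₁ U, U, rfl⟩
      refine (vanishes_incl_iff A p).1 ((hv A X (incl A) p).1 (Vanishes.of_mem_closureOver ?_ hp))
      rintro _ ⟨q, hq, rfl⟩
      exact (hv A X (incl A) q).2 ((vanishes_incl_iff A q).2 (subset_closureOver U hq))
    · intro hp
      let A' : AlgSet P L₂ := ⟨X.vars, X.finite_vars,
        solutions L₂ (MvPolynomial.map (σ : P →+* P) '' U), _, rfl⟩
      obtain ⟨A, i, hi⟩ : ∃ (A : AlgSet P L₂) (i : A ⟶ aff L₂ X), ∀ q, Vanishes i q ↔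
          q ∈ closureOver L₂ (MvPolynomial.map (σ : P →+* P) '' U) :=
        ⟨A', incl A', vanishes_incl_iff A'⟩
      -- The inclusion of the closed set over `L₂` comes, up to isomorphism, from a morphism `k`
      -- over `L₁`. The polynomials vanishing along `k` form a set closed over `L₁`, which gives the
      -- remaining inclusion.
      let d := F.objObjPreimageIso A
      obtain ⟨k, hk⟩ := F.map_surjective (d.hom ≫ i ≫ (e' X).inv)
      have hk' : F.map k ≫ (e' X).hom = d.hom ≫ i := by
        rw [hk, Category.assoc, Category.assoc, Iso.inv_hom_id, Category.comp_id]
      have h1 : ∀ q, Vanishes k q ↔ MvPolynomial.map (σ : P →+* P) q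
          ∈ closureOver L₂ (MvPolynomial.map (σ : P →+* P) '' U) := by
        intro q
        rw [← hv, hk', vanishes_comp_iso_iff, hi]
      exact (h1 p).1 (Vanishes.of_mem_closureOver
        (fun q hq => (h1 q).2 (subset_closureOver _ ⟨q, hq, rfl⟩)) hp)
  exact ⟨σ, fun X hX U p => main ⟨X, hX⟩ U p⟩

theorem isomorphicCategories_iff :
    IsomorphicCategories (AlgSet P L₁) (AlgSet P L₂) ↔ GeomEquivalentUpToSemiIso P L₁ L₂ := by
  rw [geomEquivalentUpToSemiIso_iff]
  constructor
  · rintro ⟨F, G, h⟩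
    have := h.isEquivalence
    exact exists_closuresCorrespond F
  · rintro ⟨σ, h⟩
    exact isomorphicCategories_of_bijective (transfer h) (transfer_obj_bijective h)

end Equivalence

end AlgSet

end UnivAlgGeom

theorem mainTheorem3 (P : Type*) [Field P] [Infinite P] :
    (∀ (L₁ : Type*) [Field L₁] [Algebra P L₁] (L₂ : Type*) [Field L₂] [Algebra P L₂],
      UnivAlgGeom.IsomorphicCategories (UnivAlgGeom.AlgSet P L₁) (UnivAlgGeom.AlgSet P L₂) ↔
        UnivAlgGeom.GeomEquivalentUpToSemiIso P L₁ L₂) ∧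
    (∀ F : CategoryTheory.Functor (UnivAlgGeom.PolyAlg P) (UnivAlgGeom.PolyAlg P),
      UnivAlgGeom.IsCatAutomorphism F → UnivAlgGeom.IsSemiInner F) :=
  ⟨fun _ _ _ _ _ _ => UnivAlgGeom.AlgSet.isomorphicCategories_iff,
    UnivAlgGeom.PolyAlg.isSemiInner⟩
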